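/- Let $\mathcal G=(V,E)$ be a directed acyclic graph on a finite node set $V$. For edge weights $\lambda\in\mathbb R^{E}$ let $\Lambda$ be the $V\times V$ matrix with $\Lambda_{uv}=\lambda_{uv}$ if $u\to v\in E$ and $\Lambda_{uv}=0$ otherwise, and for $\omega\in(0,\infty)^V$ let $\phi_{\mathcal G}(\lambda,\omega)=(I-\Lambda)^{-T}\,\mathrm{diag}(\omega)\,(I-\Lambda)^{-1}$. The Gaussian DAG model $\mathcal M_{\mathcal G}$ is the image of $\phi_{\mathcal G}$ in the cone $\mathrm{PD}_V$ of positive definite matrices. Let $\mathbb R[\Sigma]$ be the polynomial ring in the entries $\sigma_{uv}=\sigma_{vu}$ of a symmetric matrix, and let $\phi_{\mathcal G}^*:\mathbb R[\Sigma]\to\mathbb R[\lambda,\omega]$ be the ring map that sends $\sigma_{uv}$ to the $(u,v)$ entry of $(I-\Lambda)^{-T}\mathrm{diag}(\omega)(I-\Lambda)^{-1}$, with $\lambda$ and $\omega$ regarded as variables. Let $i\ne j$ be nodes and $K\subseteq V\setminus\{i,j\}$. Let $\mathcal M_{i\perp\!\!\!\perp j\mid K}$ be the set of $\Sigma\in\mathrm{PD}_V$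 such that $X_i\perp\!\!\!\perp X_j\mid X_K$ for $X\sim\mathcal N(0,\Sigma)$. Let $\Sigma_{iK,jK}$ be the submatrix of $\Sigma=(\sigma_{uv})$ with rows $\{i\}\cup K$ and columns $\{j\}\cup K$; its determinant is defined up to a sign that depends on the ordering. A path is a sequence of distinct nodes in which consecutive nodes are joined by an edge in either direction; an inner node $k$ of it is a collider if both of its edges on the path point into $k$. A path between $i$ and $j$ is d-connecting given $K$ if no noncollider on it lies in $K$ and, for every collider $k$ on it, $k$ or a descendant of $k$ lies in $K$. The set $K$ d-separates $i$ from $j$ if there is no such path. Assume that $K$ does not d-separate $i$ from $j$, and that every d-connecting path between $i$ and $j$ given $K$ uses the edge $a\to b\in E$. Then the following hold. 1. $\lambda_{ab}$ divides $\phi_{\mathcal G}^*(\det\Sigma_{iK,jK})$ in $\mathbb R[\lambda,\omega]$. 2. Let $\mathcal G\setminus a\to b$ be the graph $\mathcal G$ with the edge $a\to b$ deleted. Then $\mathcal M_{\mathcal G\setminus a\to b}$ is an irreducible component of $\mathcal M_{\mathcal G}\cap\mathcal M_{i\perp\!\!\!\perp j\mid K}$, in the following sense. Let $W$ be the Zariski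 closure of $\mathcal M_{\mathcal G\setminus a\to b}$ in the real space of symmetric matrices. Then $W$ is an irreducible component of the Zariski closure of $\mathcal M_{\mathcal G}\cap\mathcal M_{i\perp\!\!\!\perp j\mid K}$, $W$ meets $\mathrm{PD}_V$, and $W\cap\mathrm{PD}_V=\mathcal M_{\mathcal G\setminus a\to b}$. -/

import Mathlib

open MeasureTheory ProbabilityTheory

namespace GaussianDAG

/-! ### Directed acyclic graphs, paths and d-separation -/

section Graph

variable {V : Type*}

/-- `G` has no directed cycle (in particular no loop and no pair of opposite edges). -/
def IsAcyclic (G : Digraph V) : Prop :=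
  ∀ v, ¬ Relation.TransGen G.Adj v v

/-- The set of (directed) edges of `G`, as a type. -/
abbrev Edge (G : Digraph V) : Type _ :=
  {e : V × V // G.Adj e.1 e.2}

/-- The graph obtained from `G` by deleting the edge `a → b`. -/
def deleteEdge (G : Digraph V) (a b : V) : Digraph V where
  Adj u v := G.Adj u v ∧ ¬ (u = a ∧ v = b)

/-- `p` is a (not necessarily directed) path of `G` from `i` to `j`: a sequence of distinct nodes
in which consecutive nodes are joined by an edge, in either direction. -/
def IsPath (G : Digraph V) (i j : V) (p : List V) : Prop :=
  p.head? = some i ∧ p.getLast? = some j ∧ p.Nodup ∧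
    p.IsChain (fun u v => G.Adj u v ∨ G.Adj v u)

/-- For consecutive nodes `u, k, v` of a path, `k` is a collider: `u → k ← v`. -/
def IsCollider (G : Digraph V) (u k v : V) : Prop :=
  G.Adj u k ∧ G.Adj v k

/-- For consecutive nodes `u, k, v` of a path, the inner node `k` blocks the path given `K`: either
`k` is a noncollider that belongs to `K`, or `k` is a collider such that neither `k` nor any
descendant of `k` belongs to `K`. -/
def Blocks (G : Digraph V) (K : Finset V) (u k v : V) : Prop :=
  (¬ IsCollider G u k v ∧ k ∈ K) ∨
    (IsCollider G u k v ∧ ∀ d, Relation.ReflTransGen G.Adj k d → d ∉ K)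

/-- `K` d-separates the nodes `i` and `j` (which are distinct and outside `K`): every path from `i`
to `j` contains a node that blocks it. -/
def DSeparates (G : Digraph V) (K : Finset V) (i j : V) : Prop :=
  ∀ p, IsPath G i j p → ∃ u k v, [u, k, v] <:+: p ∧ Blocks G K u k v

/-- `p` is a d-connecting path between `i` and `j` given `K`: no node on it blocks it. -/
def IsDConnectingPath (G : Digraph V) (K : Finset V) (i j : V) (p : List V) : Prop :=
  IsPath G i j p ∧ ∀ u k v, [u, k, v] <:+: p → ¬ Blocks G K u k v

/-- The path `p` uses the edge `a → b`, in either direction of travel. -/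
def UsesEdge (p : List V) (a b : V) : Prop :=
  [a, b] <:+: p ∨ [b, a] <:+: p

end Graph

/-! ### Symmetric matrices in coordinates, and Zariski closures

A symmetric matrix is recorded by its coordinates `σ_{ij} = σ_{ji}`, indexed by unordered pairs of
nodes; the polynomial ring `ℝ[Σ]` is `MvPolynomial (Sym2 V) ℝ`. -/

section Variety

/-- The symmetric matrix with the given coordinates. -/
def symMatrix {V R : Type*} (x : Sym2 V → R) : Matrix V V R :=
  Matrix.of fun i j => x s(i, j)

/-- The cone of positive definite matrices. -/
def posDefCone (V : Type*) : Set (Sym2 V → ℝ) :=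
  {x | (symMatrix x).PosDef}

variable {τ : Type*}

/-- The Zariski closure of a subset of the real affine space `τ → ℝ`. -/
noncomputable def zariskiClosure (S : Set (τ → ℝ)) : Set (τ → ℝ) :=
  MvPolynomial.zeroLocus ℝ (MvPolynomial.vanishingIdeal ℝ S)

/-- `Z` is a real algebraic variety: the set of common zeros of an ideal. -/
def IsVariety (Z : Set (τ → ℝ)) : Prop :=
  ∃ I : Ideal (MvPolynomial τ ℝ), Z = MvPolynomial.zeroLocus ℝ I

/-- `Z` is an irreducible variety. -/
def IsIrreducibleVariety (Z : Set (τ → ℝ)) : Prop :=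
  IsVariety Z ∧ Z.Nonempty ∧
    ∀ Z₁ Z₂ : Set (τ → ℝ), IsVariety Z₁ → IsVariety Z₂ → Z = Z₁ ∪ Z₂ → Z = Z₁ ∨ Z = Z₂

/-- `W` is an irreducible component of the variety `Y`: a maximal irreducible subvariety. -/
def IsIrreducibleComponent (W Y : Set (τ → ℝ)) : Prop :=
  Maximal (fun Z => IsIrreducibleVariety Z ∧ Z ⊆ Y) W

/-- `W` is an irreducible component of the model `M ⊆ PD`: an irreducible component of the Zariski
closure of `M` that meets the cone of positive definite matrices. -/
def IsModelComponent {V : Type*} (W M : Set (Sym2 V → ℝ)) : Prop :=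
  IsIrreducibleComponent W (zariskiClosure M) ∧ (W ∩ posDefCone V).Nonempty

end Variety

/-! ### Gaussian DAG models -/

section Model

theorem measurable_coords {V : Type*} (K : Finset V) :
    Measurable (fun (X : EuclideanSpace ℝ V) (k : K) => X k) := by
  fun_prop

variable {V : Type*} [Fintype V] [DecidableEq V] {R : Type*} [CommRing R]

open Classical in
/-- The matrix `Λ` of edge weights. -/
noncomputable def edgeMatrix (G : Digraph V) (l : Edge G → R) : Matrix V V R :=
  Matrix.of fun i j => if h : G.Adj i j then l ⟨(i, j), h⟩ else 0

/-- The matrix `(I - Λ)⁻ᵀ Ω (I - Λ)⁻¹`, with `Ω` the diagonal matrix with entries `w`. For acyclic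
`G` the matrix `I - Λ` has determinant one, so the inverse is a true inverse over any `R`. -/
noncomputable def covMatrix (G : Digraph V) (l : Edge G → R) (w : V → R) : Matrix V V R :=
  ((1 - edgeMatrix G l)⁻¹).transpose * Matrix.diagonal w * (1 - edgeMatrix G l)⁻¹

theorem covMatrix_symm (G : Digraph V) (l : Edge G → R) (w : V → R) (i j : V) :
    covMatrix G l w i j = covMatrix G l w j i := by
  have h : (covMatrix G l w).transpose = covMatrix G l w := by
    simp [covMatrix, Matrix.transpose_mul, Matrix.mul_assoc]
  exact congrFun (congrFun h.symm i) j

/-- The parametrization `φ_G : (Λ, Ω) ↦ (I - Λ)⁻ᵀ Ω (I - Λ)⁻¹`, in the coordinates `σ_{ij}`. -/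
noncomputable def param (G : Digraph V) (l : Edge G → R) (w : V → R) : Sym2 V → R :=
  Sym2.lift ⟨fun i j => covMatrix G l w i j, covMatrix_symm G l w⟩

/-- The Gaussian DAG model `M_G`: the image of `φ_G` on `ℝ^E × (0, ∞)^V`. -/
def dagModel (G : Digraph V) : Set (Sym2 V → ℝ) :=
  {x | ∃ (l : Edge G → ℝ) (w : V → ℝ), (∀ v, 0 < w v) ∧ x = param G l w}

/-- The ring map `φ_G^* : ℝ[Σ] → ℝ[λ, ω]` of the parametrization, where `λ_{uv}` is the variable
`X (Sum.inl (u, v))` and `ω_v` is the variable `X (Sum.inr v)`. -/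
noncomputable def paramPullback (G : Digraph V) :
    MvPolynomial (Sym2 V) ℝ →ₐ[ℝ] MvPolynomial (Edge G ⊕ V) ℝ :=
  MvPolynomial.aeval
    (param G (fun e => MvPolynomial.X (Sum.inl e)) (fun v => MvPolynomial.X (Sum.inr v)))

/-- The polynomial `det Σ_{iK,jK}`: the rows are `i` (the index `none`) and the elements of `K`, the
columns are `j` (the index `none`) and the elements of `K`. -/
noncomputable def minorPoly (i j : V) (K : Finset V) : MvPolynomial (Sym2 V) ℝ :=
  ((symMatrix (fun s : Sym2 V => (MvPolynomial.X s : MvPolynomial (Sym2 V) ℝ))).submatrix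
    (fun r : Option K => r.elim i Subtype.val)
    (fun c : Option K => c.elim j Subtype.val)).det

/-- `X_i ⫫ X_j | X_K` for a centered Gaussian random vector `X` with covariance matrix `S`. -/
def GaussianCI (S : Matrix V V ℝ) (i j : V) (K : Finset V) : Prop :=
  CondIndepFun
    (MeasurableSpace.comap (fun (X : EuclideanSpace ℝ V) (k : K) => X k) inferInstance)
    (measurable_coords K).comap_le
    (fun X : EuclideanSpace ℝ V => X i) (fun X : EuclideanSpace ℝ V => X j)
    (multivariateGaussian 0 S)

/-- The conditional independence model `M_{i ⫫ j | K}`. -/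
def ciModel (i j : V) (K : Finset V) : Set (Sym2 V → ℝ) :=
  {x | x ∈ posDefCone V ∧ GaussianCI (symMatrix x) i j K}

end Model

end GaussianDAG

set_option linter.unusedSectionVars false

/-! Let `f` be the pullback of the minor. A path that is d-connecting without `a → b` is
d-connecting in `G` and avoids that edge, so by hypothesis `K` d-separates `i` from `j` in the
smaller graph (`dSeparates_deleteEdge`). Soundness of d-separation (`uncorr_of_not_reach`) makes `f`
vanish at all positive parameters with `λ_ab = 0`. These are Zariski dense in that hyperplane, so
`λ_ab ∣ f`. Completeness (`existsCorr_of_reach`) gives `f ≠ 0`, hence `f = λ_ab ^ m * g` with `λ_ab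
∤ g`.

The parametrization has a rational inverse: regress each node on its predecessors in a topological
order. The denominators are principal minors, positive on the positive definite cone. Hence the
closure of a model meets the cone only in the model (`zariskiClosure_dagModel_inter_posDefCone`),
and `g` times a power of the denominators is the pullback of a polynomial `h` in `Σ`
(`exists_clear_denominators`).

Let `Z` be irreducible, containing `W` and contained in the closure of the intersection, and let `q`
vanish on `W`. At each point of the intersection either `λ_ab = 0`, so the point is in the smaller
model and `q = 0`, or `g = 0`, so `h = 0`. Thus `q * h` vanishes on `Z`, and so does `q` or `h`. If
`h` did, it would vanish on `W`, and `g` on `λ_ab = 0`, contradicting `λ_ab ∤ g`. So `Z ⊆ W`.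

The linear-algebraic condition `Uncorr` mediates between the determinant (`det_minor_eq_zero_iff`),
Gaussian conditional independence (`gaussianCI_iff_uncorr`) and the combinatorial predicate `Reach`.
-/

namespace GaussianDAG

/-! ### Open walks, reachability and d-separation. -/

section Walks

variable {V : Type*} {G : Digraph V} {K : Finset V} {i j : V}

/-- `r` numbers the nodes injectively and increasingly along the edges of `G`. -/
structure IsTopOrder (G : Digraph V) (r : V → ℕ) : Prop where
  inj : Function.Injective r
  lt : ∀ {u v}, G.Adj u v → r u < r v

/-- Extend the ancestor order to a linear order and count the elements below each node. -/
theorem exists_isTopOrder [Finite V] (hG : IsAcyclic G) : ∃ r, IsTopOrder G r := by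
  have : IsPartialOrder V (Relation.ReflTransGen G.Adj) :=
    { refl := fun _ => .refl
      trans := fun _ _ _ => Relation.ReflTransGen.trans
      antisymm := by
        intro u v huv hvu
        rcases Relation.reflTransGen_iff_eq_or_transGen.1 huv with h | h
        · exact h.symm
        · exact absurd (h.trans_left hvu) (hG u) }
  obtain ⟨s, hs, hle⟩ := extend_partialOrder (Relation.ReflTransGen G.Adj)
  have hlt : ∀ u v, s u v → u ≠ v → {w | s w u}.ncard < {w | s w v}.ncard := by
    intro u v huv hne
    refine Set.ncard_lt_ncard ⟨fun w hw => _root_.trans hw huv, fun h => hne ?_⟩ (Set.toFinite _)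
    exact antisymm huv (h (refl v))
  refine ⟨fun v => {w | s w v}.ncard, ⟨fun u v huv => ?_, fun {u v} huv => ?_⟩⟩
  · by_contra hne
    rcases total_of s u v with h | h
    · exact (hlt u v h hne).ne huv
    · exact (hlt v u h (Ne.symm hne)).ne' huv
  · refine hlt u v (hle _ _ (.single huv)) ?_
    rintro rfl
    exact hG u (.single huv)

theorem IsAcyclic.asymm (hG : IsAcyclic G) {u v : V} (h : G.Adj u v) : ¬ G.Adj v u :=
  fun h' => hG u ((Relation.TransGen.single h).tail h')

/-- `u` is an ancestor of (or belongs to) the set `K`. -/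
def IsAncestor (G : Digraph V) (K : Finset V) (u : V) : Prop :=
  ∃ d ∈ K, Relation.ReflTransGen G.Adj u d

theorem IsAncestor.head {u v : V} (h : IsAncestor G K v) (huv : G.Adj u v) : IsAncestor G K u := by
  obtain ⟨d, hd, hvd⟩ := h
  exact ⟨d, hd, hvd.head huv⟩

/-- No inner node of the walk `p` blocks it. -/
def IsOpenWalk (G : Digraph V) (K : Finset V) (p : List V) : Prop :=
  ∀ u k v, [u, k, v] <:+: p → ¬ Blocks G K u k v

theorem not_blocks_iff {u k v : V} :
    ¬ Blocks G K u k v ↔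
      (¬ IsCollider G u k v → k ∉ K) ∧ (IsCollider G u k v → IsAncestor G K k) := by
  unfold Blocks IsAncestor
  push Not
  constructor
  · rintro ⟨h₁, h₂⟩
    refine ⟨h₁, fun h => ?_⟩
    obtain ⟨d, hd, hdK⟩ := h₂ h
    exact ⟨d, hdK, hd⟩
  · rintro ⟨h₁, h₂⟩
    refine ⟨h₁, fun h => ?_⟩
    obtain ⟨d, hd, hdK⟩ := h₂ h
    exact ⟨d, hdK, hd⟩

theorem IsOpenWalk.infix {p q : List V} (h : IsOpenWalk G K p) (hq : q <:+: p) :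
    IsOpenWalk G K q :=
  fun u k v hu => h u k v (hu.trans hq)

theorem isOpenWalk_singleton (v : V) : IsOpenWalk G K [v] := by
  intro u k w h
  have := h.length_le
  simp at this

theorem isOpenWalk_cons {a b : V} {t : List V} :
    IsOpenWalk G K (a :: b :: t) ↔
      IsOpenWalk G K (b :: t) ∧ ∀ c t', t = c :: t' → ¬ Blocks G K a b c := by
  constructor
  · intro h
    refine ⟨h.infix (List.suffix_cons a _).isInfix, ?_⟩
    rintro c t' rfl
    exact h a b c (List.IsPrefix.isInfix ⟨t', rfl⟩)
  · rintro ⟨h₁, h₂⟩ u k v h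
    rcases List.infix_cons_iff.1 h with ⟨t', ht'⟩ | h
    · simp only [List.cons_append, List.nil_append, List.cons.injEq] at ht'
      obtain ⟨rfl, rfl, rfl⟩ := ht'
      exact h₂ _ _ rfl
    · exact h₁ u k v h

theorem isOpenWalk_split {v : V} {l₁ l₂ : List V} :
    IsOpenWalk G K (l₁ ++ v :: l₂) ↔
      IsOpenWalk G K (l₁ ++ [v]) ∧ IsOpenWalk G K (v :: l₂) ∧
        ∀ a l₁' b l₂', l₁ = l₁' ++ [a] → l₂ = b :: l₂' → ¬ Blocks G K a v b := by
  constructor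
  · intro h
    refine ⟨h.infix (List.IsPrefix.isInfix ⟨l₂, by simp⟩),
      h.infix (List.suffix_append _ _).isInfix, ?_⟩
    rintro a l₁' b l₂' rfl rfl
    exact h a v b ⟨l₁', l₂', by simp⟩
  · rintro ⟨h₁, h₂, h₃⟩
    induction l₁ with
    | nil => exact h₂
    | cons a t ih =>
      cases t with
      | nil =>
        refine isOpenWalk_cons.2 ⟨h₂, ?_⟩
        rintro c t' rfl
        exact h₃ a [] c t' rfl rfl
      | cons b t =>
        obtain ⟨h₄, h₅⟩ := isOpenWalk_cons.1 h₁
        refine isOpenWalk_cons.2 ⟨ih h₄ fun a' l₁' b' l₂' h h' => ?_, ?_⟩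
        · exact h₃ a' (a :: l₁') b' l₂' (by rw [h]; rfl) h'
        · intro c t' h
          cases t with
          | nil =>
            cases h
            exact h₅ v [] rfl
          | cons d t =>
            cases h
            exact h₅ _ (t ++ [v]) rfl

theorem IsOpenWalk.reverse {p : List V} (h : IsOpenWalk G K p) : IsOpenWalk G K p.reverse := by
  intro u k v huv
  have h' : [v, k, u] <:+: p := by
    rw [← List.reverse_infix]
    simpa using huv
  have h₁ := not_blocks_iff.1 (h v k u h')
  refine not_blocks_iff.2 ⟨fun hc => h₁.1 fun hc' => hc hc'.symm, fun hc => h₁.2 hc.symm⟩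

/-- An open walk that leaves its first node `v` along an edge out of `v` is directed, unless `v` is
an ancestor of `K`. -/
theorem isAncestor_or_directed :
    ∀ (l : List V) (v : V), (v :: l).IsChain (fun a b => G.Adj a b ∨ G.Adj b a) →
      IsOpenWalk G K (v :: l) → (∀ c t, l = c :: t → G.Adj v c) →
      IsAncestor G K v ∨ ∀ x ∈ l, Relation.TransGen G.Adj v x := by
  intro l
  induction l with
  | nil => simp
  | cons c t ih =>
    intro v hch hop hfirst
    have hvc := hfirst c t rfl
    obtain ⟨hop', hb⟩ := isOpenWalk_cons.1 hop
    by_cases hc : ∀ e t', t = e :: t' → G.Adj c e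
    · rcases ih c (List.isChain_cons_cons.1 hch).2 hop' hc with h | h
      · exact .inl (h.head hvc)
      · refine .inr fun x hx => ?_
        rcases List.mem_cons.1 hx with rfl | hx
        · exact .single hvc
        · exact .head hvc (h x hx)
    -- The walk turns around at `c`, an open collider, so `c` and with it `v` are ancestors of `K`.
    · push Not at hc
      obtain ⟨e, t', rfl, hce⟩ := hc
      have hec : G.Adj e c := by
        have : G.Adj c e ∨ G.Adj e c := by
          exact (List.isChain_cons_cons.1 (List.isChain_cons_cons.1 hch).2).1
        tauto
      exact .inl (((not_blocks_iff.1 (hb e t' rfl)).2 ⟨hvc, hec⟩).head hvc)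

theorem exists_loop_of_not_nodup {p : List V} (h : ¬ p.Nodup) :
    ∃ l₁ v l₂ l₃, p = l₁ ++ v :: (l₂ ++ v :: l₃) := by
  induction p with
  | nil => simp at h
  | cons a t ih =>
    by_cases ha : a ∈ t
    · obtain ⟨l₂, l₃, rfl⟩ := List.append_of_mem ha
      exact ⟨[], a, l₂, l₃, rfl⟩
    · obtain ⟨l₁, v, l₂, l₃, rfl⟩ := ih (by simpa [ha] using h)
      exact ⟨a :: l₁, v, l₂, l₃, rfl⟩

/-- Only `v` gets new neighbours. If it is a noncollider between them, it was one on some visit, so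
`v ∉ K`. If it is a collider but no ancestor of `K`, it was a noncollider on the first visit, so the
loop leaves `v` along an outgoing edge and is a directed cycle. -/
theorem isOpenWalk_remove_loop (hG : IsAcyclic G) {v : V} {l₁ l₂ l₃ : List V}
    (hch : (l₁ ++ v :: (l₂ ++ v :: l₃)).IsChain (fun a b => G.Adj a b ∨ G.Adj b a))
    (hop : IsOpenWalk G K (l₁ ++ v :: (l₂ ++ v :: l₃))) : IsOpenWalk G K (l₁ ++ v :: l₃) := by
  obtain ⟨h₁, h₂, h₃⟩ := isOpenWalk_split.1 hop
  obtain ⟨h₄, h₅, h₆⟩ := (isOpenWalk_split (l₁ := v :: l₂)).1 h₂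
  refine isOpenWalk_split.2 ⟨h₁, h₅, ?_⟩
  rintro a l₁' b l₃' rfl rfl
  have hch₂ : ((v :: l₂) ++ [v]).IsChain (fun a b => G.Adj a b ∨ G.Adj b a) :=
    ((List.isChain_split (l₁ := v :: l₂)).1 (List.isChain_split.1 hch).2).1
  obtain ⟨c, m, hcm⟩ : ∃ c m, l₂ ++ [v] = c :: m := by
    cases l₂ with
    | nil => exact ⟨_, _, rfl⟩
    | cons c m => exact ⟨c, m ++ [v], rfl⟩
  obtain ⟨n, d, hnd⟩ : ∃ n d, v :: l₂ = n ++ [d] := by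
    rcases List.eq_nil_or_concat (v :: l₂) with h | ⟨n, d, h⟩
    · simp at h
    · exact ⟨n, d, by simpa using h⟩
  have hac := not_blocks_iff.1 (h₃ a l₁' c (m ++ b :: l₃') rfl (by
    have : l₂ ++ v :: b :: l₃' = (l₂ ++ [v]) ++ b :: l₃' := by simp
    rw [this, hcm]; rfl))
  have hdb := not_blocks_iff.1 (h₆ d n b l₃' hnd rfl)
  refine not_blocks_iff.2 ⟨fun hnc hvK => ?_, fun hc => ?_⟩
  · refine hnc ⟨?_, ?_⟩
    · by_contra h
      exact hac.1 (fun hc => h hc.1) hvK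
    · by_contra h
      exact hdb.1 (fun hc => h hc.2) hvK
  · by_contra hanc
    have hcv : ¬ G.Adj c v := fun h => hanc (hac.2 ⟨hc.1, h⟩)
    rw [List.cons_append, hcm] at hch₂ h₄
    have hvc : G.Adj v c := by
      have := (List.isChain_cons_cons.1 hch₂).1
      tauto
    rcases isAncestor_or_directed _ _ hch₂ h₄ (by rintro c' t' h; cases h; exact hvc) with h | h
    · exact hanc h
    · exact hG v (h v (by rw [← hcm]; simp))

theorem exists_isDConnectingPath (hG : IsAcyclic G) :
    ∀ (n : ℕ) (p : List V), p.length = n → p.head? = some i → p.getLast? = some j →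
      p.IsChain (fun a b => G.Adj a b ∨ G.Adj b a) → IsOpenWalk G K p →
      ∃ q, IsDConnectingPath G K i j q := by
  intro n
  induction n using Nat.strong_induction_on with
  | _ n ih =>
    intro p hp hi hj hch hop
    by_cases hnd : p.Nodup
    · exact ⟨p, ⟨hi, hj, hnd, hch⟩, hop⟩
    · obtain ⟨l₁, v, l₂, l₃, rfl⟩ := exists_loop_of_not_nodup hnd
      refine ih _ ?_ (l₁ ++ v :: l₃) rfl ?_ ?_ ?_ (isOpenWalk_remove_loop hG hch hop)
      · rw [← hp]; simp
      · cases l₁ <;> simpa using hi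
      · simpa [List.getLast?_append, List.getLast?_cons] using hj
      · have h := List.isChain_split.1 hch
        have h' := (List.isChain_split (l₁ := v :: l₂)).1 h.2
        exact List.isChain_split.2 ⟨h.1, h'.2⟩

/-- The nodes reached from `j` by walks that `K` does not block; the Boolean records whether the
last edge of the walk points into the node reached. -/
inductive Reach (G : Digraph V) (K : Finset V) (j : V) : Bool → V → Prop
  | start : Reach G K j false j
  | fwd {s : Bool} {u v : V} : Reach G K j s u → u ∉ K → G.Adj u v → Reach G K j true v
  | up {u v : V} : Reach G K j false u → u ∉ K → G.Adj v u → Reach G K j false v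
  | bounce {u v : V} : Reach G K j true u → IsAncestor G K u → G.Adj v u → Reach G K j false v

/-- The walk is listed from `v` back to `j`, so each step of `Reach` conses a node. The last two
clauses keep the direction of the edge at `v`, which decides whether `v` becomes a collider at the
next step. -/
theorem Reach.exists_walk (hG : IsAcyclic G) {s : Bool} {v : V} (h : Reach G K j s v) :
    ∃ l, (v :: l).getLast? = some j ∧ (v :: l).IsChain (fun a b => G.Adj a b ∨ G.Adj b a) ∧
      IsOpenWalk G K (v :: l) ∧ (s = true → ∀ u t, l = u :: t → G.Adj u v) ∧
      (s = false → ∀ u t, l = u :: t → G.Adj v u) := by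
  induction h with
  | start => exact ⟨[], by simp, by simp, isOpenWalk_singleton j, by simp, by simp⟩
  | @fwd s u v _ hu huv ih =>
    obtain ⟨l, h₁, h₂, h₃, -, -⟩ := ih
    refine ⟨u :: l, by simpa [List.getLast?_cons] using h₁, List.isChain_cons_cons.2 ⟨.inr huv, h₂⟩,
      isOpenWalk_cons.2 ⟨h₃, ?_⟩, ?_, by simp⟩
    · rintro c t -
      exact not_blocks_iff.2 ⟨fun _ => hu, fun hc => absurd hc.1 (hG.asymm huv)⟩
    · rintro - c t h
      cases h; exact huv
  | @up u v _ hu hvu ih =>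
    obtain ⟨l, h₁, h₂, h₃, -, h₅⟩ := ih
    refine ⟨u :: l, by simpa [List.getLast?_cons] using h₁, List.isChain_cons_cons.2 ⟨.inl hvu, h₂⟩,
      isOpenWalk_cons.2 ⟨h₃, ?_⟩, by simp, ?_⟩
    · rintro c t h
      exact not_blocks_iff.2 ⟨fun _ => hu, fun hc => absurd hc.2 (hG.asymm (h₅ rfl c t h))⟩
    · rintro - c t h
      cases h; exact hvu
  | @bounce u v _ hu hvu ih =>
    obtain ⟨l, h₁, h₂, h₃, h₄, -⟩ := ih
    refine ⟨u :: l, by simpa [List.getLast?_cons] using h₁, List.isChain_cons_cons.2 ⟨.inl hvu, h₂⟩,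
      isOpenWalk_cons.2 ⟨h₃, ?_⟩, by simp, ?_⟩
    · rintro c t h
      exact not_blocks_iff.2 ⟨fun hc => absurd ⟨hvu, h₄ rfl c t h⟩ hc, fun _ => hu⟩
    · rintro - c t h
      cases h; exact hvu

theorem exists_reach_of_walk (hG : IsAcyclic G) (hjK : j ∉ K) :
    ∀ (l : List V) (v : V), (v :: l).getLast? = some j →
      (v :: l).IsChain (fun a b => G.Adj a b ∨ G.Adj b a) → IsOpenWalk G K (v :: l) →
      ∃ s, Reach G K j s v ∧ (s = true → ∃ u t, l = u :: t ∧ G.Adj u v) ∧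
        (s = false → ∀ u t, l = u :: t → G.Adj v u) := by
  intro l
  induction l with
  | nil =>
    intro v hv _ _
    obtain rfl : v = j := by simpa using hv
    exact ⟨false, .start, by simp, by simp⟩
  | cons u t ih =>
    intro v hv hch hop
    obtain ⟨huv, hch'⟩ := List.isChain_cons_cons.1 hch
    obtain ⟨hop', hb⟩ := isOpenWalk_cons.1 hop
    have hu : (u :: t).getLast? = some j := by simpa [List.getLast?_cons] using hv
    -- At the end of the walk no triple constrains `u`; there `u = j` and `j ∉ K` is used.
    have hnK : (∀ c t', t = c :: t' → ¬ IsCollider G v u c) → u ∉ K := by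
      intro h
      cases t with
      | nil =>
        obtain rfl : u = j := by simpa using hu
        exact hjK
      | cons c t' => exact (not_blocks_iff.1 (hb c t' rfl)).1 (h c t' rfl)
    obtain ⟨s, hs, hst, hsf⟩ := ih u hu hch' hop'
    rcases huv with huv | huv
    · cases s with
      | true =>
        obtain ⟨c, t', rfl, hcu⟩ := hst rfl
        refine ⟨false, .bounce hs ((not_blocks_iff.1 (hb c t' rfl)).2 ⟨huv, hcu⟩) huv, by simp, ?_⟩
        rintro - x y h
        cases h; exact huv
      | false =>
        refine ⟨false, .up hs (hnK fun c t' h hc => ?_) huv, by simp, ?_⟩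
        · exact hG.asymm (hsf rfl c t' h) hc.2
        · rintro - x y h
          cases h; exact huv
    · exact ⟨true, .fwd hs (hnK fun c t' _ hc => hG.asymm huv hc.1) huv,
        fun _ => ⟨u, t, rfl, huv⟩, by simp⟩

/-- `Reach` grows from one end only, but the walks that it describes can be reversed. -/
theorem Reach.symm (hG : IsAcyclic G) (hiK : i ∉ K) {s : Bool} (h : Reach G K j s i) :
    ∃ s', Reach G K i s' j := by
  obtain ⟨l, h₁, h₂, h₃, -⟩ := h.exists_walk hG
  obtain ⟨m, hm⟩ : ∃ m, (i :: l).reverse = j :: m := by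
    have : (i :: l).reverse.head? = some j := by rwa [List.head?_reverse]
    exact ⟨_, List.eq_cons_of_mem_head? this⟩
  have hlast : (j :: m).getLast? = some i := by
    rw [← hm, List.getLast?_reverse]; rfl
  have hch : (j :: m).IsChain (fun a b => G.Adj a b ∨ G.Adj b a) := by
    rw [← hm, List.isChain_reverse]
    exact h₂.imp fun a b h => h.symm
  obtain ⟨s', hs', -⟩ := exists_reach_of_walk hG hiK m j hlast hch (hm ▸ h₃.reverse)
  exact ⟨s', hs'⟩

theorem not_reach_of_dSeparates (hG : IsAcyclic G) (h : DSeparates G K i j) (s : Bool) :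
    ¬ Reach G K j s i := by
  intro hr
  obtain ⟨l, h₁, h₂, h₃, -⟩ := hr.exists_walk hG
  obtain ⟨q, hq, hop⟩ := exists_isDConnectingPath hG _ (i :: l) rfl rfl h₁ h₂ h₃
  obtain ⟨u, k, v, huv, hb⟩ := h q hq
  exact hop u k v huv hb

theorem exists_reach_of_not_dSeparates (hG : IsAcyclic G) (hjK : j ∉ K)
    (h : ¬ DSeparates G K i j) : ∃ s, Reach G K j s i := by
  unfold DSeparates at h
  push Not at h
  obtain ⟨p, ⟨hi, hj, -, hch⟩, hop⟩ := h
  obtain ⟨l, rfl⟩ : ∃ l, p = i :: l := ⟨_, List.eq_cons_of_mem_head? hi⟩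
  obtain ⟨s, hs, -⟩ := exists_reach_of_walk hG hjK l i hj hch hop
  exact ⟨s, hs⟩

theorem IsAcyclic.deleteEdge (hG : IsAcyclic G) (a b : V) :
    IsAcyclic (GaussianDAG.deleteEdge G a b) :=
  fun v h => hG v (Relation.TransGen.mono (fun _ _ h => h.1) _ _ h)

/-- Acyclicity forbids opposite edges, so both graphs see the same colliders on a path of the
smaller one, and deleting an edge only loses descendants. Hence an open path of the smaller graph
stays open in `G`. -/
theorem dSeparates_deleteEdge (hG : IsAcyclic G) {a b : V} (hab : G.Adj a b)
    (huse : ∀ p, IsDConnectingPath G K i j p → UsesEdge p a b) :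
    DSeparates (deleteEdge G a b) K i j := by
  rintro p ⟨hi, hj, hnd, hch⟩
  by_contra hop
  push Not at hop
  have hadj : ∀ {u v}, [u, v] <:+: p → (deleteEdge G a b).Adj u v ∨ (deleteEdge G a b).Adj v u := by
    intro u v h
    simpa using hch.infix h
  have hcol : ∀ {u v}, [u, v] <:+: p →
      (G.Adj u v → (deleteEdge G a b).Adj u v) ∧ (G.Adj v u → (deleteEdge G a b).Adj v u) := by
    intro u v h
    rcases hadj h with h' | h'
    · exact ⟨fun _ => h', fun h => absurd h (hG.asymm h'.1)⟩
    · exact ⟨fun h => absurd h (hG.asymm h'.1), fun _ => h'⟩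
  have hG' : IsDConnectingPath G K i j p := by
    refine ⟨⟨hi, hj, hnd, hch.imp fun u v h => h.imp (·.1) (·.1)⟩, fun u k v huv hb => ?_⟩
    have huk : [u, k] <:+: p := List.IsInfix.trans ⟨[], [v], rfl⟩ huv
    have hkv : [k, v] <:+: p := List.IsInfix.trans ⟨[u], [], rfl⟩ huv
    refine hop u k v huv ?_
    rcases hb with ⟨h₁, h₂⟩ | ⟨h₁, h₂⟩
    · exact .inl ⟨fun hc => h₁ ⟨hc.1.1, hc.2.1⟩, h₂⟩
    · exact .inr ⟨⟨(hcol huk).1 h₁.1, (hcol hkv).2 h₁.2⟩,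
        fun d hd => h₂ d (Relation.ReflTransGen.mono (fun _ _ h => h.1) _ _ hd)⟩
  rcases huse p hG' with h | h
  · rcases hadj h with h' | h'
    · exact h'.2 ⟨rfl, rfl⟩
    · exact hG.asymm hab h'.1
  · rcases hadj h with h' | h'
    · exact hG.asymm hab h'.1
    · exact h'.2 ⟨rfl, rfl⟩

end Walks

/-! ### Inverses of unitriangular matrices and covariance matrices. -/

section Cov

open Matrix

variable {V : Type*} [Fintype V] [DecidableEq V] {R : Type*} [CommRing R]
  {r : V → ℕ} {L L' : Matrix V V R} {w : V → R}

/-- Nonzero entries of `L` occur only at pairs that `r` numbers increasingly. -/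
def IsStrictUpper (r : V → ℕ) (L : Matrix V V R) : Prop :=
  ∀ u v, L u v ≠ 0 → r u < r v

theorem IsStrictUpper.det_one_sub (hL : IsStrictUpper r L) : (1 - L).det = 1 := by
  have hzero : ∀ u v, r v ≤ r u → L u v = 0 := fun u v h => by
    by_contra h'
    exact absurd (hL u v h') (not_lt.2 h)
  have hb : (1 - L).BlockTriangular r := by
    refine blockTriangular_one.sub fun u v huv => hzero u v huv.le
  rw [hb.det]
  refine Finset.prod_eq_one fun a _ => ?_
  have : (1 - L).toSquareBlock r a = 1 := by
    ext ⟨u, hu⟩ ⟨v, hv⟩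
    simp [toSquareBlock_def, Matrix.one_apply, hzero u v (hv.trans hu.symm).le]
  rw [this, det_one]

theorem IsStrictUpper.inv_mul (hL : IsStrictUpper r L) : (1 - L)⁻¹ * (1 - L) = 1 :=
  nonsing_inv_mul _ (by rw [hL.det_one_sub]; exact isUnit_one)

theorem IsStrictUpper.mul_inv (hL : IsStrictUpper r L) : (1 - L) * (1 - L)⁻¹ = 1 :=
  mul_nonsing_inv _ (by rw [hL.det_one_sub]; exact isUnit_one)

/-- The recursion `N = 1 + N L` for `N = (1 - L)⁻¹`. Since `L u v ≠ 0` forces `r u < r v`, it drives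
the inductions on `r v` below. -/
theorem IsStrictUpper.inv_apply (hL : IsStrictUpper r L) (c v : V) :
    (1 - L)⁻¹ c v = (1 : Matrix V V R) c v + ∑ u, (1 - L)⁻¹ c u * L u v := by
  have h := congrFun (congrFun hL.inv_mul c) v
  rw [mul_sub, mul_one, Matrix.sub_apply, mul_apply] at h
  rw [← h]; ring

/-- `A` contains every `u` with `L u v ≠ 0` for some `v` in `A`. -/
def IsAncestral (L : Matrix V V R) (A : Set V) : Prop :=
  ∀ u v, v ∈ A → L u v ≠ 0 → u ∈ A

theorem IsStrictUpper.inv_apply_eq_zero (hL : IsStrictUpper r L) {A : Set V}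
    (hA : IsAncestral L A) {c : V} (hc : c ∉ A) :
    ∀ v ∈ A, (1 - L)⁻¹ c v = 0 := by
  suffices ∀ n, ∀ v ∈ A, r v = n → (1 - L)⁻¹ c v = 0 from fun v hv => this _ v hv rfl
  intro n
  induction n using Nat.strong_induction_on with
  | _ n ih =>
    intro v hv hn
    have hcv : c ≠ v := fun h => hc (h ▸ hv)
    rw [hL.inv_apply, one_apply_ne hcv, zero_add]
    refine Finset.sum_eq_zero fun u _ => ?_
    by_cases hu : L u v = 0
    · rw [hu, mul_zero]
    · rw [ih (r u) (hn ▸ hL u v hu) u (hA u v hv hu) rfl, zero_mul]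

theorem IsStrictUpper.inv_apply_congr (hL : IsStrictUpper r L) (hL' : IsStrictUpper r L')
    {A : Set V} (hA : IsAncestral L A) (h : ∀ u, ∀ v ∈ A, L u v = L' u v) (c : V) :
    ∀ v ∈ A, (1 - L)⁻¹ c v = (1 - L')⁻¹ c v := by
  suffices ∀ n, ∀ v ∈ A, r v = n → (1 - L)⁻¹ c v = (1 - L')⁻¹ c v from
    fun v hv => this _ v hv rfl
  intro n
  induction n using Nat.strong_induction_on with
  | _ n ih =>
    intro v hv hn
    rw [hL.inv_apply, hL'.inv_apply]
    congr 1
    refine Finset.sum_congr rfl fun u _ => ?_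
    rw [← h u v hv]
    by_cases hu : L u v = 0
    · rw [hu, mul_zero, mul_zero]
    · rw [ih (r u) (hn ▸ hL u v hu) u (hA u v hv hu) rfl]

theorem IsStrictUpper.inv_apply_eq_zero_of_lt (hL : IsStrictUpper r L) {u v : V}
    (h : r v < r u) : (1 - L)⁻¹ u v = 0 :=
  hL.inv_apply_eq_zero (A := {x | r x ≤ r v}) (fun _ _ hy hxy => (hL _ _ hxy).le.trans hy)
    (by simpa using h) v (by simp)

theorem IsStrictUpper.inv_apply_self (hL : IsStrictUpper r L) (v : V) :
    (1 - L)⁻¹ v v = 1 := by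
  rw [hL.inv_apply, one_apply_eq]
  refine add_eq_left.2 (Finset.sum_eq_zero fun u _ => ?_)
  by_cases hu : L u v = 0
  · rw [hu, mul_zero]
  · rw [hL.inv_apply_eq_zero_of_lt (hL u v hu), zero_mul]

/-- The matrix `(1 - L)⁻ᵀ diag(w) (1 - L)⁻¹`. -/
noncomputable def cov (L : Matrix V V R) (w : V → R) : Matrix V V R :=
  ((1 - L)⁻¹)ᵀ * diagonal w * (1 - L)⁻¹

theorem cov_apply (L : Matrix V V R) (w : V → R) (u v : V) :
    cov L w u v = ∑ c, (1 - L)⁻¹ c u * w c * (1 - L)⁻¹ c v := by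
  rw [cov, mul_apply]
  simp only [mul_diagonal, transpose_apply]

theorem IsStrictUpper.cov_mul (hL : IsStrictUpper r L) :
    cov L w * (1 - L) = ((1 - L)⁻¹)ᵀ * diagonal w := by
  rw [cov, Matrix.mul_assoc, hL.inv_mul, Matrix.mul_one]

theorem IsStrictUpper.eq_cov_of_transpose_mul_mul (hL : IsStrictUpper r L) {S : Matrix V V R}
    (h : (1 - L)ᵀ * S * (1 - L) = diagonal w) : S = cov L w := by
  have h' : ((1 - L)⁻¹)ᵀ * (1 - L)ᵀ = 1 := by
    rw [← transpose_mul, hL.mul_inv, transpose_one]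
  rw [cov, ← h]
  simp only [Matrix.mul_assoc, hL.mul_inv, Matrix.mul_one]
  rw [← Matrix.mul_assoc, h', Matrix.one_mul]

theorem cov_posDef {L : Matrix V V ℝ} {w : V → ℝ} (hL : IsStrictUpper r L) (hw : ∀ v, 0 < w v) :
    (cov L w).PosDef := by
  have h := (PosDef.diagonal hw).conjTranspose_mul_mul_same (B := (1 - L)⁻¹)
    (mulVec_injective_of_isUnit
      ((isUnit_iff_isUnit_det _).2 (by rw [det_nonsing_inv, hL.det_one_sub]; simp)))
  simpa [cov] using h

theorem IsStrictUpper.cov_congr (hL : IsStrictUpper r L) (hL' : IsStrictUpper r L')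
    {A : Set V} (hA : IsAncestral L A) (h : ∀ u, ∀ v ∈ A, L u v = L' u v) {u v : V}
    (hu : u ∈ A) (hv : v ∈ A) : cov L w u v = cov L' w u v := by
  simp only [cov_apply]
  refine Finset.sum_congr rfl fun c _ => ?_
  rw [hL.inv_apply_congr hL' hA h c u hu, hL.inv_apply_congr hL' hA h c v hv]

/-- Raising one error variance is a rank-one change. On nodes not later than `t` it touches only the
entry `(t, t)`, which `existsCorr_of_erase` exploits. -/
theorem cov_update (w : V → R) (t : V) (s : R) (u v : V) :
    cov L (w + Pi.single t s) u v = cov L w u v + s * ((1 - L)⁻¹ t u * (1 - L)⁻¹ t v) := by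
  simp only [cov_apply, Pi.add_apply, mul_add, add_mul, Finset.sum_add_distrib]
  congr 1
  rw [Finset.sum_eq_single t]
  · simp; ring
  · intro b _ hb
    simp [Pi.single_eq_of_ne hb]
  · simp

end Cov

/-! ### Vanishing partial correlation as linear algebra. -/

section Uncorr

open Matrix

variable {V : Type*} [Fintype V] [DecidableEq V] {S : Matrix V V ℝ} {i j : V} {K : Finset V}

/-- Some linear combination `X_j + ∑ k ∈ K, x k • X_k` is uncorrelated with `X_i` and with every
`X_k`, `k ∈ K`, if `X` has covariance matrix `S`. -/
def Uncorr (S : Matrix V V ℝ) (i j : V) (K : Finset V) : Prop :=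
  ∃ x : V → ℝ, x j = 1 ∧ (∀ v, v ∉ insert j K → x v = 0) ∧ ∀ v ∈ insert i K, (S *ᵥ x) v = 0

theorem eq_zero_of_mulVec_eq_zero (hS : S.PosDef) {T : Finset V} {x : V → ℝ}
    (hx : ∀ v ∉ T, x v = 0) (h : ∀ v ∈ T, (S *ᵥ x) v = 0) : x = 0 := by
  by_contra hne
  have h₁ := hS.dotProduct_mulVec_pos hne
  have h₂ : star x ⬝ᵥ S *ᵥ x = 0 := by
    refine Finset.sum_eq_zero fun v _ => ?_
    by_cases hv : v ∈ T
    · rw [h v hv, mul_zero]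
    · simp [hx v hv]
  exact h₁.ne' h₂

theorem mulVec_apply_congr {S' : Matrix V V ℝ} {x : V → ℝ} {u v : V}
    (h : ∀ y, x y ≠ 0 → S u y = S' v y) : (S *ᵥ x) u = (S' *ᵥ x) v := by
  simp only [mulVec, dotProduct]
  refine Finset.sum_congr rfl fun y _ => ?_
  by_cases hy : x y = 0
  · rw [hy, mul_zero, mul_zero]
  · rw [h y hy]

theorem not_uncorr_self (hS : S.PosDef) : ¬ Uncorr S i i K := by
  rintro ⟨x, hi, hx, h⟩
  have := eq_zero_of_mulVec_eq_zero hS hx h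
  simp [this] at hi

/-- The coefficients on `K` solve the normal equations of the regression of `X_j` on `X_K`; the
principal submatrix on `K` is invertible. -/
theorem exists_residual (hS : S.PosDef) (hjK : j ∉ K) :
    ∃ x : V → ℝ, x j = 1 ∧ (∀ v, v ∉ insert j K → x v = 0) ∧ ∀ v ∈ K, (S *ᵥ x) v = 0 := by
  have hM : (S.submatrix (Subtype.val : K → V) Subtype.val).PosDef :=
    hS.submatrix Subtype.val_injective
  obtain ⟨y, hy⟩ := (mulVec_surjective_iff_isUnit.2 hM.isUnit) (fun k : K => - S k j)
  refine ⟨fun v => if v = j then 1 else if h : v ∈ K then y ⟨v, h⟩ else 0, by simp, ?_, ?_⟩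
  · intro v hv
    simp only [Finset.mem_insert, not_or] at hv
    simp [hv.1, hv.2]
  · intro v hv
    have h := congrFun hy ⟨v, hv⟩
    simp only [mulVec, dotProduct, submatrix_apply] at h ⊢
    rw [← Finset.sum_subset (Finset.subset_univ (insert j K)), Finset.sum_insert hjK,
      ← Finset.sum_coe_sort K]
    · have : ∀ k : K, (k : V) ≠ j := fun k h => hjK (h ▸ k.2)
      rw [Finset.univ_eq_attach] at h
      simp [this, h]
    · intro u _ hu
      simp only [Finset.mem_insert, not_or] at hu
      simp [hu.1, hu.2]

theorem dotProduct_mulVec_comm (hS : S.PosDef) (x y : V → ℝ) : x ⬝ᵥ S *ᵥ y = y ⬝ᵥ S *ᵥ x := by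
  have : S.IsSymm := by simpa using hS.1
  rw [dotProduct_mulVec, ← mulVec_transpose, this.eq, dotProduct_comm]

theorem dotProduct_mulVec_eq {x y : V → ℝ} (hj : x j = 1)
    (hx : ∀ v, v ∉ insert j K → x v = 0) (h : ∀ v ∈ K, (S *ᵥ y) v = 0) :
    x ⬝ᵥ S *ᵥ y = (S *ᵥ y) j := by
  rw [dotProduct, Finset.sum_eq_single j]
  · rw [hj, one_mul]
  · intro v _ hv
    by_cases hvK : v ∈ K
    · rw [h v hvK, mul_zero]
    · rw [hx v (by simp [hv, hvK]), zero_mul]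
  · simp

/-- For the residual vectors `x` of `j` and `y` of `i`, the number `xᵀ S y` equals both `(S y) j`
and `(S x) i`. -/
theorem Uncorr.symm (hS : S.PosDef) (hiK : i ∉ K) (h : Uncorr S i j K) :
    Uncorr S j i K := by
  obtain ⟨x, hj, hx, hSx⟩ := h
  obtain ⟨y, hi, hy, hSy⟩ := exists_residual hS hiK
  refine ⟨y, hi, hy, fun v hv => ?_⟩
  rcases Finset.mem_insert.1 hv with rfl | hv
  · rw [← dotProduct_mulVec_eq hj hx hSy, dotProduct_mulVec_comm hS,
      dotProduct_mulVec_eq hi hy fun v hv => hSx v (Finset.mem_insert_of_mem hv)]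
    exact hSx i (Finset.mem_insert_self _ _)
  · exact hSy v hv

/-- The submatrix with rows `{i} ∪ K` and columns `{j} ∪ K`. -/
def minor {R : Type*} (S : Matrix V V R) (i j : V) (K : Finset V) :
    Matrix (Option K) (Option K) R :=
  S.submatrix (fun a => a.elim i Subtype.val) (fun a => a.elim j Subtype.val)

theorem sum_option_elim {f : V → ℝ} (hjK : j ∉ K) (hf : ∀ v, v ∉ insert j K → f v = 0) :
    ∑ a : Option K, f (a.elim j Subtype.val) = ∑ v, f v := by
  rw [← Finset.sum_subset (Finset.subset_univ (insert j K)) fun v _ hv => hf v hv,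
    Finset.sum_insert hjK, ← Finset.sum_coe_sort K, Fintype.sum_option]
  simp

/-- A kernel vector of the minor is a residual vector up to scale: its `j` coordinate is nonzero,
since otherwise it would be supported on `K`, where `S` is definite. -/
theorem det_minor_eq_zero_iff (hS : S.PosDef) (hiK : i ∉ K) (hjK : j ∉ K) :
    (minor S i j K).det = 0 ↔ Uncorr S i j K := by
  rw [← exists_mulVec_eq_zero_iff]
  have key : ∀ (x : V → ℝ), (∀ v, v ∉ insert j K → x v = 0) → ∀ a : Option K,
      (minor S i j K *ᵥ fun b => x (b.elim j Subtype.val)) a =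
        (S *ᵥ x) (a.elim i Subtype.val) := by
    intro x hx a
    simp only [mulVec, dotProduct, minor, submatrix_apply]
    exact sum_option_elim (f := fun v => S (a.elim i Subtype.val) v * x v) hjK
      fun v hv => by rw [hx v hv, mul_zero]
  constructor
  · rintro ⟨y, hy, h⟩
    set x : V → ℝ := fun v => if v = j then y none else if h : v ∈ K then y (some ⟨v, h⟩) else 0
      with hxdef
    have hx : ∀ v, v ∉ insert j K → x v = 0 := by
      intro v hv
      simp only [Finset.mem_insert, not_or] at hv
      simp [hxdef, hv.1, hv.2]
    have hxy : (fun b : Option K => x (b.elim j Subtype.val)) = y := by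
      funext b
      cases b with
      | none => simp [hxdef]
      | some k =>
        have : (k : V) ≠ j := fun h => hjK (h ▸ k.2)
        simp [hxdef, this]
    have hSx : ∀ v ∈ insert i K, (S *ᵥ x) v = 0 := by
      intro v hv
      rcases Finset.mem_insert.1 hv with rfl | hv
      · have := key x hx none
        rw [hxy, h] at this
        exact this.symm
      · have := key x hx (some ⟨v, hv⟩)
        rw [hxy, h] at this
        exact this.symm
    have hj : x j ≠ 0 := by
      intro hj
      have : x = 0 := by
        refine eq_zero_of_mulVec_eq_zero hS (T := K) (fun v hv => ?_)
          fun v hv => hSx v (Finset.mem_insert_of_mem hv)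
        by_cases hvj : v = j
        · rw [hvj, hj]
        · exact hx v (by simp [hv, hvj])
      apply hy
      rw [← hxy, this]
      rfl
    refine ⟨(x j)⁻¹ • x, by simp [hj], fun v hv => by simp [hx v hv], fun v hv => ?_⟩
    rw [mulVec_smul, Pi.smul_apply, hSx v hv, smul_zero]
  · rintro ⟨x, hj, hx, h⟩
    refine ⟨fun b => x (b.elim j Subtype.val), fun h0 => ?_, ?_⟩
    · have := congrFun h0 none
      simp [hj] at this
    · funext a
      rw [key x hx a]
      cases a with
      | none => exact h i (Finset.mem_insert_self _ _)
      | some k => exact h k (Finset.mem_insert_of_mem k.2)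

end Uncorr

/-! ### The parametrization and its pullback. -/

section Param

open Matrix

variable {V : Type*} [Fintype V] [DecidableEq V] {R : Type*} [CommRing R]
  {G : Digraph V} {r : V → ℕ}

theorem edgeMatrix_of_adj (l : Edge G → R) {u v : V} (h : G.Adj u v) :
    edgeMatrix G l u v = l ⟨(u, v), h⟩ := by
  simp [edgeMatrix, h]

theorem edgeMatrix_of_not_adj (l : Edge G → R) {u v : V} (h : ¬ G.Adj u v) :
    edgeMatrix G l u v = 0 := by
  simp [edgeMatrix, h]

theorem adj_of_edgeMatrix_ne_zero {l : Edge G → R} {u v : V} (h : edgeMatrix G l u v ≠ 0) :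
    G.Adj u v := by
  by_contra h'
  exact h (edgeMatrix_of_not_adj l h')

theorem IsTopOrder.isStrictUpper (hr : IsTopOrder G r) {L : Matrix V V R}
    (hL : ∀ u v, L u v ≠ 0 → G.Adj u v) : IsStrictUpper r L :=
  fun u v h => hr.lt (hL u v h)

theorem IsTopOrder.isStrictUpper_edgeMatrix (hr : IsTopOrder G r) (l : Edge G → R) :
    IsStrictUpper r (edgeMatrix G l) :=
  hr.isStrictUpper fun _ _ => adj_of_edgeMatrix_ne_zero

theorem edgeMatrix_eq {L : Matrix V V R} (hL : ∀ u v, L u v ≠ 0 → G.Adj u v) :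
    edgeMatrix G (fun e => L e.1.1 e.1.2) = L := by
  ext u v
  by_cases h : G.Adj u v
  · rw [edgeMatrix_of_adj _ h]
  · rw [edgeMatrix_of_not_adj _ h]
    by_contra h'
    exact h (hL u v (Ne.symm h'))

theorem symMatrix_param (l : Edge G → R) (w : V → R) :
    symMatrix (param G l w) = cov (edgeMatrix G l) w := rfl

theorem symMatrix_injective {R : Type*} :
    Function.Injective (symMatrix : (Sym2 V → R) → Matrix V V R) := by
  intro x y h
  funext s
  induction s using Sym2.ind with
  | _ u v => exact congrFun (congrFun h u) v

theorem mem_dagModel_iff {x : Sym2 V → ℝ} :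
    x ∈ dagModel G ↔ ∃ (L : Matrix V V ℝ) (w : V → ℝ), (∀ u v, L u v ≠ 0 → G.Adj u v) ∧
      (∀ v, 0 < w v) ∧ symMatrix x = cov L w := by
  constructor
  · rintro ⟨l, w, hw, rfl⟩
    exact ⟨edgeMatrix G l, w, fun _ _ => adj_of_edgeMatrix_ne_zero, hw, rfl⟩
  · rintro ⟨L, w, hL, hw, hx⟩
    refine ⟨fun e => L e.1.1 e.1.2, w, hw, symMatrix_injective ?_⟩
    rw [hx, symMatrix_param, edgeMatrix_eq hL]

theorem edgeMatrix_map {R' : Type*} [CommRing R'] (f : R →+* R') (l : Edge G → R) :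
    (edgeMatrix G l).map f = edgeMatrix G (fun e => f (l e)) := by
  ext u v
  by_cases h : G.Adj u v
  · simp [edgeMatrix_of_adj _ h]
  · simp [edgeMatrix_of_not_adj _ h]

theorem IsStrictUpper.cov_map {R' : Type*} [CommRing R'] (f : R →+* R') {L : Matrix V V R}
    (hL : IsStrictUpper r L) (w : V → R) :
    (cov L w).map f = cov (L.map f) (fun v => f (w v)) := by
  have h1 : (1 - L).map f = 1 - L.map f := by
    rw [Matrix.map_sub f (map_sub f), Matrix.map_one f (map_zero f) (map_one f)]
  have hinv : (1 - L.map f)⁻¹ = ((1 - L)⁻¹).map f := by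
    refine inv_eq_left_inv ?_
    rw [← h1, ← Matrix.map_mul, hL.inv_mul, Matrix.map_one f (map_zero f) (map_one f)]
  rw [cov, cov, hinv, Matrix.map_mul, Matrix.map_mul, transpose_map, diagonal_map (map_zero f)]

theorem IsTopOrder.aeval_paramPullback (hr : IsTopOrder G r) (l : Edge G → ℝ) (w : V → ℝ)
    (p : MvPolynomial (Sym2 V) ℝ) :
    MvPolynomial.aeval (Sum.elim l w) (paramPullback G p) =
      MvPolynomial.aeval (param G l w) p := by
  rw [paramPullback, ← AlgHom.comp_apply, MvPolynomial.comp_aeval]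
  congr 2
  refine symMatrix_injective ?_
  rw [symMatrix_param]
  have h := (hr.isStrictUpper_edgeMatrix fun e => (MvPolynomial.X (Sum.inl e) :
    MvPolynomial (Edge G ⊕ V) ℝ)).cov_map
      (MvPolynomial.aeval (R := ℝ) (Sum.elim l w)).toRingHom fun v => MvPolynomial.X (Sum.inr v)
  rw [edgeMatrix_map] at h
  simpa [symMatrix_param] using! h

theorem aeval_minorPoly (x : Sym2 V → ℝ) (i j : V) (K : Finset V) :
    MvPolynomial.aeval x (minorPoly i j K) = (minor (symMatrix x) i j K).det := by
  rw [minorPoly, AlgHom.map_det]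
  congr 1
  ext a b
  simp [minor, symMatrix]

/-- The parameter domain is a product of infinite sets, hence Zariski dense. -/
theorem exists_pos_aeval_ne_zero {f : MvPolynomial (Edge G ⊕ V) ℝ} (hf : f ≠ 0) :
    ∃ (l : Edge G → ℝ) (w : V → ℝ), (∀ v, 0 < w v) ∧
      MvPolynomial.aeval (Sum.elim l w) f ≠ 0 := by
  by_contra! h
  refine hf (MvPolynomial.funext_set
    (Sum.elim (fun _ : Edge G => Set.univ) (fun _ : V => Set.Ioi (0 : ℝ))) ?_ ?_)
  · rintro (e | v)
    · exact Set.infinite_univ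
    · exact Set.Ioi_infinite 0
  · intro x hx
    have := h (fun e => x (Sum.inl e)) (fun v => x (Sum.inr v)) fun v => hx (Sum.inr v) trivial
    have hx' : Sum.elim (fun e => x (Sum.inl e)) (fun v => x (Sum.inr v)) = x :=
      Sum.elim_comp_inl_inr x
    rw [hx'] at this
    simpa [MvPolynomial.aeval_eq_eval] using this

theorem IsTopOrder.paramPullback_minorPoly_ne_zero_iff (hr : IsTopOrder G r) {i j : V}
    {K : Finset V} (hiK : i ∉ K) (hjK : j ∉ K) :
    paramPullback G (minorPoly i j K) ≠ 0 ↔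
      ∃ (L : Matrix V V ℝ) (w : V → ℝ), (∀ u v, L u v ≠ 0 → G.Adj u v) ∧ (∀ v, 0 < w v) ∧
        ¬ Uncorr (cov L w) i j K := by
  constructor
  · intro h
    obtain ⟨l, w, hw, h⟩ := exists_pos_aeval_ne_zero h
    refine ⟨edgeMatrix G l, w, fun _ _ => adj_of_edgeMatrix_ne_zero, hw, fun hu => h ?_⟩
    rw [hr.aeval_paramPullback, aeval_minorPoly, symMatrix_param,
      det_minor_eq_zero_iff (cov_posDef (hr.isStrictUpper_edgeMatrix l) hw) hiK hjK]
    exact hu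
  · rintro ⟨L, w, hL, hw, hu⟩ h
    refine hu ((det_minor_eq_zero_iff (cov_posDef (hr.isStrictUpper hL) hw) hiK hjK).1 ?_)
    rw [← edgeMatrix_eq hL, ← symMatrix_param, ← aeval_minorPoly, ← hr.aeval_paramPullback, h,
      map_zero]

/-- The parameter ring is a domain, so two nonzero pullbacks have a common positive parameter at
which neither vanishes. -/
theorem IsTopOrder.exists_not_uncorr_and (hr : IsTopOrder G r) {i j i' j' : V}
    {K K' : Finset V} (hiK : i ∉ K) (hjK : j ∉ K) (hiK' : i' ∉ K') (hjK' : j' ∉ K')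
    (h : ∃ (L : Matrix V V ℝ) (w : V → ℝ), (∀ u v, L u v ≠ 0 → G.Adj u v) ∧ (∀ v, 0 < w v) ∧
        ¬ Uncorr (cov L w) i j K)
    (h' : ∃ (L : Matrix V V ℝ) (w : V → ℝ), (∀ u v, L u v ≠ 0 → G.Adj u v) ∧ (∀ v, 0 < w v) ∧
        ¬ Uncorr (cov L w) i' j' K') :
    ∃ (L : Matrix V V ℝ) (w : V → ℝ), (∀ u v, L u v ≠ 0 → G.Adj u v) ∧ (∀ v, 0 < w v) ∧
        ¬ Uncorr (cov L w) i j K ∧ ¬ Uncorr (cov L w) i' j' K' := by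
  rw [← hr.paramPullback_minorPoly_ne_zero_iff hiK hjK] at h
  rw [← hr.paramPullback_minorPoly_ne_zero_iff hiK' hjK'] at h'
  obtain ⟨l, w, hw, hlw⟩ := exists_pos_aeval_ne_zero (mul_ne_zero h h')
  have hS := cov_posDef (hr.isStrictUpper_edgeMatrix l) hw
  rw [map_mul, hr.aeval_paramPullback, hr.aeval_paramPullback, aeval_minorPoly, aeval_minorPoly,
    symMatrix_param] at hlw
  refine ⟨edgeMatrix G l, w, fun _ _ => adj_of_edgeMatrix_ne_zero, hw, fun hu => ?_, fun hu => ?_⟩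
  · exact left_ne_zero_of_mul hlw ((det_minor_eq_zero_iff hS hiK hjK).2 hu)
  · exact right_ne_zero_of_mul hlw ((det_minor_eq_zero_iff hS hiK' hjK').2 hu)

end Param

/-! ### Soundness: d-separation forces partial correlations to vanish. -/

section Soundness

open Matrix

variable {V : Type*} {G : Digraph V} {K : Finset V} {i j : V}

theorem Reach.descend {s : Bool} {u d : V} (h : Reach G K j s u) (hu : ¬ IsAncestor G K u)
    (hud : Relation.ReflTransGen G.Adj u d) : ∃ s', Reach G K j s' d := by
  induction hud with
  | refl => exact ⟨s, h⟩
  | @tail b c hub hbc ih =>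
    obtain ⟨s', hs'⟩ := ih
    exact ⟨true, .fwd hs' (fun hb => hu ⟨b, hb, hub⟩) hbc⟩

theorem reach_of_ancestor {u : V} (hu : ¬ IsAncestor G K u)
    (huj : Relation.ReflTransGen G.Adj u j) : Reach G K j false u := by
  induction huj using Relation.ReflTransGen.head_induction_on with
  | refl => exact .start
  | head huc _ ih =>
    have hc := fun h => hu (IsAncestor.head h huc)
    exact .up (ih hc) (fun h => hc ⟨_, h, .refl⟩) huc

/-- If `u` is an ancestor of `K`, the walk may continue to the parent `v`. Otherwise directed paths
from `u` avoid `K`: one leads down to `i`, or one to `j`, and then its reverse from `j` passes up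
through `u` to `v`. -/
theorem Reach.parent [DecidableEq V] {s : Bool} {u v : V} (h : Reach G K j s u)
    (hu : s = true ∨ u ∉ K) (hA : IsAncestor G (insert i (insert j K)) u) (hvu : G.Adj v u) :
    (∃ s', Reach G K j s' v) ∨ ∃ s', Reach G K j s' i := by
  by_cases hK : IsAncestor G K u
  · left
    cases s with
    | true => exact ⟨_, .bounce h hK hvu⟩
    | false => exact ⟨_, .up h (by simpa using hu) hvu⟩
  · obtain ⟨d, hd, hud⟩ := hA
    simp only [Finset.mem_insert] at hd
    rcases hd with rfl | rfl | hd
    · exact .inr (h.descend hK hud)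
    · exact .inl ⟨_, .up (reach_of_ancestor hK hud) (fun h => hK ⟨_, h, .refl⟩) hvu⟩
    · exact absurd ⟨d, hd, hud⟩ hK

/-- Rescale the residual vector of `i` on `T.erase i`. -/
theorem exists_dual_vector [Fintype V] [DecidableEq V] {S : Matrix V V ℝ} (hS : S.PosDef)
    {T : Finset V} (hi : i ∈ T) :
    ∃ z : V → ℝ, (∀ v ∉ T, z v = 0) ∧ ∀ v ∈ T, (S *ᵥ z) v = if v = i then 1 else 0 := by
  obtain ⟨x, hx1, hx, hSx⟩ := exists_residual hS (Finset.notMem_erase i T)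
  rw [Finset.insert_erase hi] at hx
  have hne : (S *ᵥ x) i ≠ 0 := by
    intro h
    have := eq_zero_of_mulVec_eq_zero hS hx fun v hv => by
      by_cases hvi : v = i
      · rw [hvi, h]
      · exact hSx v (Finset.mem_erase.2 ⟨hvi, hv⟩)
    simp [this] at hx1
  refine ⟨((S *ᵥ x) i)⁻¹ • x, fun v hv => by simp [hx v hv], fun v hv => ?_⟩
  rw [mulVec_smul, Pi.smul_apply, smul_eq_mul]
  split_ifs with h
  · rw [h, inv_mul_cancel₀ hne]
  · rw [hSx v (Finset.mem_erase.2 ⟨h, hv⟩), mul_zero]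

variable [Fintype V] [DecidableEq V] {r : V → ℕ}

/-- The inverse of `cov L w`. -/
noncomputable def concentration (L : Matrix V V ℝ) (w : V → ℝ) : Matrix V V ℝ :=
  (1 - L) * diagonal (fun v => (w v)⁻¹) * (1 - L)ᵀ

theorem cov_mul_concentration {L : Matrix V V ℝ} {w : V → ℝ} (hL : IsStrictUpper r L)
    (hw : ∀ v, 0 < w v) : cov L w * concentration L w = 1 := by
  have hd : diagonal w * diagonal (fun v => (w v)⁻¹) = 1 := by
    rw [diagonal_mul_diagonal, ← diagonal_one]
    congr 1
    funext v
    exact mul_inv_cancel₀ (hw v).ne'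
  rw [concentration, ← Matrix.mul_assoc, ← Matrix.mul_assoc, hL.cov_mul,
    Matrix.mul_assoc _ (diagonal w), hd, Matrix.mul_one, ← transpose_mul, hL.mul_inv,
    transpose_one]

theorem concentration_posDef {L : Matrix V V ℝ} {w : V → ℝ} (hL : IsStrictUpper r L)
    (hw : ∀ v, 0 < w v) : (concentration L w).PosDef := by
  have h := (cov_posDef hL hw).inv
  rwa [inv_eq_right_inv (cov_mul_concentration hL hw)] at h

/-- Off the diagonal, nonzero concentrations only join neighbours in the moral graph: adjacent nodes
or nodes with a common child. -/
theorem exists_of_concentration_ne_zero {L : Matrix V V ℝ} {w : V → ℝ} {u v : V}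
    (h : concentration L w u v ≠ 0) : ∃ c, (u = c ∨ L u c ≠ 0) ∧ (v = c ∨ L v c ≠ 0) := by
  rw [concentration, mul_apply] at h
  obtain ⟨c, -, hc⟩ := Finset.exists_ne_zero_of_sum_ne_zero h
  rw [mul_diagonal, transpose_apply] at hc
  have key : ∀ x, (1 - L) x c ≠ 0 → x = c ∨ L x c ≠ 0 := by
    intro x hx
    by_contra! h'
    exact hx (by rw [Matrix.sub_apply, one_apply_ne h'.1, h'.2, sub_zero])
  exact ⟨c, key u (left_ne_zero_of_mul (left_ne_zero_of_mul hc)), key v (right_ne_zero_of_mul hc)⟩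

/-- Restrict to the ancestral set `A` of `i`, `j`, `K`, and let `T` be its unreached nodes outside
`K`. The concentration matrix `Θ` has no entries between `T` and the other nodes outside `K`. Choose
`z` supported on `T` such that `Θ z` is the unit vector at `i` on `T`. Then `x = Θ z` is supported
on `insert i K`, and `Σ x = z` vanishes at `j` and on `K`. -/
theorem uncorr_of_not_reach (hr : IsTopOrder G r) (hiK : i ∉ K) (hjK : j ∉ K)
    (h : ∀ s, ¬ Reach G K j s i) {L : Matrix V V ℝ} (hL : ∀ u v, L u v ≠ 0 → G.Adj u v)
    {w : V → ℝ} (hw : ∀ v, 0 < w v) : Uncorr (cov L w) j i K := by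
  classical
  set A : Set V := {u | IsAncestor G (insert i (insert j K)) u} with hA
  have hAG : ∀ u v, v ∈ A → G.Adj u v → u ∈ A := fun u v hv huv => IsAncestor.head hv huv
  have hanc : IsAncestral L A := fun u v hv huv => hAG u v hv (hL u v huv)
  have hmem : ∀ u ∈ insert i (insert j K), u ∈ A := fun u hu => ⟨u, hu, .refl⟩
  -- Edges into nodes outside `A` do not affect covariances within `A`, but could marry parents in
  -- the moral graph.
  set L' : Matrix V V ℝ := Matrix.of fun u v => if v ∈ A then L u v else 0 with hL'
  have hL'A : ∀ u v, L' u v ≠ 0 → G.Adj u v ∧ v ∈ A := by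
    intro u v huv
    by_cases hv : v ∈ A
    · exact ⟨hL u v (by simpa [hL', hv] using huv), hv⟩
    · simp [hL', hv] at huv
  have hU := hr.isStrictUpper hL
  have hU' := hr.isStrictUpper fun u v huv => (hL'A u v huv).1
  have hcov : ∀ u ∈ A, ∀ v ∈ A, cov L w u v = cov L' w u v := fun u hu v hv =>
    hU.cov_congr hU' hanc (fun u v hv => by simp [hL', hv]) hu hv
  set T : Finset V := Finset.univ.filter fun v => v ∈ A ∧ v ∉ K ∧ ∀ s, ¬ Reach G K j s v with hT
  have hsep : ∀ v ∈ T, ∀ u ∉ T, u ∉ K → concentration L' w u v = 0 := by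
    intro v hv u hu huK
    by_contra hne
    obtain ⟨c, huc, hvc⟩ := exists_of_concentration_ne_zero hne
    simp only [hT, Finset.mem_filter, Finset.mem_univ, true_and] at hv hu
    obtain ⟨hvA, hvK, hvR⟩ := hv
    have huA : u ∈ A := by
      rcases huc with rfl | huc
      · rcases hvc with rfl | hvc
        · exact hvA
        · exact (hL'A _ _ hvc).2
      · exact hAG _ _ (hL'A _ _ huc).2 (hL'A _ _ huc).1
    have huR : ∃ s, Reach G K j s u := by
      by_contra! h'
      exact hu ⟨huA, huK, h'⟩
    obtain ⟨s, hs⟩ := huR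
    have hno : ¬ ((∃ s', Reach G K j s' v) ∨ ∃ s', Reach G K j s' i) := by
      rintro (⟨s, hs⟩ | ⟨s, hs⟩)
      · exact hvR s hs
      · exact h s hs
    rcases huc with rfl | huc
    · rcases hvc with rfl | hvc
      · exact hvR s hs
      · exact hno (hs.parent (.inr huK) huA (hL'A _ _ hvc).1)
    · have hc := Reach.fwd hs huK (hL'A _ _ huc).1
      rcases hvc with rfl | hvc
      · exact hvR _ hc
      · exact hno (hc.parent (.inl rfl) (hL'A _ _ huc).2 (hL'A _ _ hvc).1)
  have hiT : i ∈ T := by simpa [hT, hiK, h] using hmem i (by simp)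
  obtain ⟨z, hz, hΘz⟩ := exists_dual_vector (concentration_posDef hU' hw) hiT
  have hx : ∀ v, v ∉ insert i K → (concentration L' w *ᵥ z) v = 0 := by
    intro v hv
    simp only [Finset.mem_insert, not_or] at hv
    by_cases hvT : v ∈ T
    · rw [hΘz v hvT, if_neg hv.1]
    · refine Finset.sum_eq_zero fun u _ => ?_
      by_cases hu : u ∈ T
      · exact mul_eq_zero_of_left (hsep u hu v hvT hv.2) _
      · rw [hz u hu, mul_zero]
  refine ⟨concentration L' w *ᵥ z, by rw [hΘz i hiT, if_pos rfl], hx, fun v hv => ?_⟩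
  have hvA : v ∈ A := hmem v (Finset.mem_insert_of_mem hv)
  have hzv : z v = 0 := by
    refine hz v fun hvT => ?_
    simp only [hT, Finset.mem_filter, Finset.mem_univ, true_and] at hvT
    rcases Finset.mem_insert.1 hv with rfl | hv
    · exact hvT.2.2 _ .start
    · exact hvT.2.1 hv
  have : (cov L w *ᵥ (concentration L' w *ᵥ z)) v =
      (cov L' w *ᵥ (concentration L' w *ᵥ z)) v := by
    refine mulVec_apply_congr fun u hu => hcov v hvA u (hmem u ?_)
    have := fun h => hu (hx u h)
    simp only [Finset.mem_insert] at this ⊢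
    tauto
  rw [this, mulVec_mulVec, cov_mul_concentration hU' hw, one_mulVec, hzv]

end Soundness

/-! ### Completeness: an open walk yields a parameter with nonzero partial correlation. -/

section Completeness

open Matrix

variable {V : Type*} {G : Digraph V} {K : Finset V} {i j t : V} {r : V → ℕ}

/-- Going back along the walk, the arrows out of `v` lead to `j` or to an open collider. -/
theorem Reach.isAncestor [DecidableEq V] {v : V} (h : Reach G K j false v) :
    IsAncestor G (insert j K) v := by
  generalize hs : false = s at h
  induction h with
  | start => exact ⟨j, Finset.mem_insert_self _ _, .refl⟩
  | fwd => simp at hs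
  | up _ _ hvu ih => exact (ih hs).head hvu
  | bounce _ hu hvu _ =>
    obtain ⟨d, hd, hud⟩ := hu
    exact ⟨d, Finset.mem_insert_of_mem hd, hud.head hvu⟩

/-- Shrinking `K` can only close colliders. From the first one that closes, a directed path leads to
`t` and meets no node of `K.erase t`. -/
theorem Reach.erase [DecidableEq V] {s : Bool} {v : V} (h : Reach G K j s v) (t : V) :
    Reach G (K.erase t) j s v ∨ ∃ s', Reach G (K.erase t) j s' t := by
  induction h with
  | start => exact .inl .start
  | fwd _ hu huv ih => exact ih.imp_left fun h => .fwd h (fun h => hu (Finset.mem_of_mem_erase h)) huv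
  | up _ hu huv ih => exact ih.imp_left fun h => .up h (fun h => hu (Finset.mem_of_mem_erase h)) huv
  | @bounce u v _ hu huv ih =>
    rcases ih with ih | ih
    · by_cases hu' : IsAncestor G (K.erase t) u
      · exact .inl (.bounce ih hu' huv)
      · obtain ⟨d, hd, hud⟩ := hu
        obtain rfl : d = t := by
          by_contra hdt
          exact hu' ⟨d, Finset.mem_erase.2 ⟨hdt, hd⟩, hud⟩
        exact .inr (ih.descend hu' hud)
    · exact .inr ih

theorem IsTopOrder.le_of_reflTransGen (hr : IsTopOrder G r) {u v : V}
    (h : Relation.ReflTransGen G.Adj u v) : r u ≤ r v := by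
  induction h with
  | refl => exact le_rfl
  | tail _ h ih => exact ih.trans (hr.lt h).le

/-- If `i` comes after `j` and `K`, a walk that reaches `i` from `j` ends with an edge into `i`. -/
theorem Reach.exists_adj [DecidableEq V] (hr : IsTopOrder G r) {s : Bool} (h : Reach G K j s i)
    (hij : r j < r i) (hK : ∀ k ∈ K, r k < r i) :
    ∃ s' u, Reach G K j s' u ∧ u ∉ K ∧ G.Adj u i := by
  cases h with
  | start => exact absurd hij (lt_irrefl _)
  | fwd hu huK hui => exact ⟨_, _, hu, huK, hui⟩
  | up hu huK hiu =>
    obtain ⟨d, hd, hud⟩ := hu.isAncestor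
    have h1 := (hr.lt hiu).trans_le (hr.le_of_reflTransGen hud)
    rcases Finset.mem_insert.1 hd with rfl | hd
    · exact absurd hij h1.not_gt
    · exact absurd (hK d hd) h1.not_gt
  | bounce _ hu hiu =>
    obtain ⟨d, hd, hud⟩ := hu
    exact absurd (hK d hd) ((hr.lt hiu).trans_le (hr.le_of_reflTransGen hud)).not_gt

variable [Fintype V] [DecidableEq V]

theorem IsStrictUpper.cov_isAncestral_of_lt {L : Matrix V V ℝ} (hL : IsStrictUpper r L) (n : ℕ) :
    IsAncestral L {v | r v < n} :=
  fun u v hv huv => (hL u v huv).trans hv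

/-- Replacing the column of a late node `i` by a unit column at `u` gives `X_i = X_u + ε_i`. -/
theorem not_uncorr_replace_column (hr : IsTopOrder G r) {L : Matrix V V ℝ} {w : V → ℝ}
    (hL : ∀ u v, L u v ≠ 0 → G.Adj u v) {u : V} (hui : G.Adj u i)
    (hij : r j < r i) (hK : ∀ k ∈ K, r k < r i) (h : ¬ Uncorr (cov L w) u j K) :
    ∃ L' : Matrix V V ℝ, (∀ u v, L' u v ≠ 0 → G.Adj u v) ∧ ¬ Uncorr (cov L' w) i j K := by
  set L' : Matrix V V ℝ := Matrix.of fun x y => if y = i then (if x = u then 1 else 0) else L x y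
    with hL'
  have hL'G : ∀ x y, L' x y ≠ 0 → G.Adj x y := by
    intro x y hxy
    by_cases hy : y = i
    · by_cases hx : x = u
      · rw [hx, hy]; exact hui
      · simp [hL', hy, hx] at hxy
    · exact hL x y (by simpa [hL', hy] using hxy)
  refine ⟨L', hL'G, fun hu => h ?_⟩
  have hU := hr.isStrictUpper hL
  have hU' := hr.isStrictUpper hL'G
  have hcov : ∀ x y, r x < r i → r y < r i → cov L w x y = cov L' w x y := fun x y hx hy =>
    hU.cov_congr hU' (hU.cov_isAncestral_of_lt (r i)) (fun a b hb => by
      have : b ≠ i := fun h => lt_irrefl (r i) (h ▸ hb)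
      simp [hL', this]) hx hy
  have hcol : ∀ y, r y < r i → cov L' w i y = cov L' w u y := by
    intro y hy
    have hB : ∀ c, (1 - L')⁻¹ c i = (1 : Matrix V V ℝ) c i + (1 - L')⁻¹ c u := by
      intro c
      rw [hU'.inv_apply]
      simp [hL']
    rw [cov_apply, cov_apply]
    simp only [hB, add_mul, Finset.sum_add_distrib]
    refine add_eq_right.2 (Finset.sum_eq_zero fun c _ => ?_)
    by_cases hc : c = i
    · rw [hc, hU'.inv_apply_eq_zero_of_lt hy, mul_zero]
    · rw [one_apply_ne hc, zero_mul, zero_mul]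
  obtain ⟨x, hj, hx, hSx⟩ := hu
  have hlt : ∀ v ∈ insert j K, r v < r i := by
    intro v hv
    rcases Finset.mem_insert.1 hv with rfl | hv
    · exact hij
    · exact hK v hv
  have hSx' : ∀ v, r v < r i → (cov L w *ᵥ x) v = (cov L' w *ᵥ x) v := by
    intro v hv
    refine mulVec_apply_congr fun y hy => hcov v y hv (hlt y ?_)
    by_contra h
    exact hy (hx y h)
  refine ⟨x, hj, hx, fun v hv => ?_⟩
  rcases Finset.mem_insert.1 hv with rfl | hv
  · rw [hSx' _ (hr.lt hui), ← hSx i (Finset.mem_insert_self _ _)]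
    refine mulVec_apply_congr fun y hy => (hcol y (hlt y ?_)).symm
    by_contra h
    exact hy (hx y h)
  · rw [hSx' v (hK v hv), hSx v (Finset.mem_insert_of_mem hv)]

/-- The effect on `Uncorr` of increasing the variance of a single variable `X_t`, `t ∈ K`. -/
theorem uncorr_erase_of_uncorr {S S' : Matrix V V ℝ} (hS : S.PosDef) (ht : t ∈ K)
    (hit : i ≠ t) (hjt : j ≠ t) (hjK : j ∉ K)
    (hS' : ∀ u ∈ insert i K, ∀ v ∈ insert j K, S' u v = S u v + if u = t ∧ v = t then 1 else 0)
    (h : Uncorr S i j K) (h' : Uncorr S' i j K) :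
    Uncorr S i j (K.erase t) ∧ (Uncorr S i t (K.erase t) ∨ Uncorr S t j (K.erase t)) := by
  obtain ⟨x, hxj, hx, hSx⟩ := h
  obtain ⟨y, hyj, hy, hSy⟩ := h'
  have hsub : ∀ v ∈ insert i (K.erase t), v ∈ insert i K := fun v hv =>
    Finset.insert_subset_insert _ (Finset.erase_subset _ _) hv
  have hne : ∀ v ∈ insert i (K.erase t), v ≠ t := by
    rintro v hv rfl
    simp [Ne.symm hit] at hv
  have htj : ∀ v, v ∉ insert t (K.erase t) → v ∉ K := by
    intro v hv
    rwa [Finset.insert_erase ht] at hv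
  have hSy' : ∀ u ∈ insert i K, (S *ᵥ y) u = - if u = t then y t else 0 := by
    intro u hu
    have h1 : (S' *ᵥ y) u = (S *ᵥ y) u + if u = t then y t else 0 := by
      have : ∀ v, S' u v * y v = S u v * y v + if v = t then (if u = t then y t else 0) else 0 := by
        intro v
        by_cases hv : v ∈ insert j K
        · rw [hS' u hu v hv]
          by_cases hvt : v = t <;> by_cases hut : u = t <;> simp [hvt, hut, add_mul]
        · have hvt : v ≠ t := fun h => hv (by simp [h, ht])
          simp [hy v hv, hvt]
      simp only [mulVec, dotProduct, this, Finset.sum_add_distrib]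
      simp
    rw [hSy u hu] at h1
    linarith
  have hSd : ∀ u ∈ insert i K, (S *ᵥ (y - x)) u = - if u = t then y t else 0 := by
    intro u hu
    rw [mulVec_sub, Pi.sub_apply, hSy' u hu, hSx u hu, sub_zero]
  have hd : ∀ v ∉ K, (y - x) v = 0 := by
    intro v hv
    by_cases hvj : v = j
    · simp [hvj, hxj, hyj]
    · have : v ∉ insert j K := by simp [hv, hvj]
      simp [hx v this, hy v this]
  -- The vector `y - x` is supported on `K`, and on `insert i K` its image under `S` vanishes except
  -- possibly at `t`. If its `t` coordinate is zero, definiteness gives `y = x` and `x t = 0`, so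
  -- `x` serves for both claims. Otherwise it rescales to the residual vector of `t` on `K.erase t`,
  -- uncorrelated with `i`, and a multiple of it clears the `t` coordinate of `x`.
  by_cases hc : (y - x) t = 0
  · have hyx : y - x = 0 := by
      refine eq_zero_of_mulVec_eq_zero hS (T := K.erase t) (fun v hv => ?_) fun v hv => ?_
      · by_cases hvt : v = t
        · rw [hvt, hc]
        · exact hd v fun hvK => hv (Finset.mem_erase.2 ⟨hvt, hvK⟩)
      · rw [hSd v (by simp [Finset.mem_of_mem_erase hv]), if_neg (Finset.ne_of_mem_erase hv), neg_zero]
    have hyt : y t = 0 := by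
      have := hSd t (by simp [ht])
      rw [hyx] at this
      simpa using this
    have hxt : x t = 0 := by
      have := congrFun hyx t
      simp only [Pi.sub_apply, Pi.zero_apply, hyt] at this
      linarith
    have hx' : ∀ v, v ∉ insert j (K.erase t) → x v = 0 := by
      intro v hv
      by_cases hvt : v = t
      · rw [hvt, hxt]
      · exact hx v (by simpa [hvt] using hv)
    refine ⟨⟨x, hxj, hx', fun v hv => hSx v (hsub v hv)⟩, .inr ⟨x, hxj, hx', fun v hv => hSx v ?_⟩⟩
    rw [Finset.insert_erase ht] at hv
    exact Finset.mem_insert_of_mem hv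
  · set u : V → ℝ := ((y - x) t)⁻¹ • (y - x) with hu
    have hut : u t = 1 := by simp only [hu, Pi.smul_apply, smul_eq_mul, inv_mul_cancel₀ hc]
    have hu0 : ∀ v ∉ K, u v = 0 := fun v hv => by simp only [hu, Pi.smul_apply, hd v hv, smul_zero]
    have hSu : ∀ v ∈ insert i (K.erase t), (S *ᵥ u) v = 0 := by
      intro v hv
      rw [hu, mulVec_smul, Pi.smul_apply, hSd v (hsub v hv), if_neg (hne v hv), neg_zero, smul_zero]
    refine ⟨⟨x - x t • u, ?_, fun v hv => ?_, fun v hv => ?_⟩, .inl ⟨u, hut, fun v hv => hu0 v (htj v hv), hSu⟩⟩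
    · simp [hxj, hu0 j hjK]
    · by_cases hvt : v = t
      · simp [hvt, hut]
      · have h1 : v ∉ insert j K := by simpa [hvt] using hv
        have h2 : v ∉ K := fun h => h1 (Finset.mem_insert_of_mem h)
        simp [hx v h1, hu0 v h2]
    · rw [mulVec_sub, mulVec_smul, Pi.sub_apply, Pi.smul_apply, hSx v (hsub v hv), hSu v hv,
        smul_zero, sub_zero]

/-- Some parameter of `G` yields a covariance matrix in which `i` and `j` are partially correlated
given `K`. -/
def ExistsCorr (G : Digraph V) (i j : V) (K : Finset V) : Prop :=
  ∃ (L : Matrix V V ℝ) (w : V → ℝ), (∀ u v, L u v ≠ 0 → G.Adj u v) ∧ (∀ v, 0 < w v) ∧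
    ¬ Uncorr (cov L w) i j K

theorem ExistsCorr.symm (hr : IsTopOrder G r) (hjK : j ∉ K)
    (h : ExistsCorr G i j K) : ExistsCorr G j i K := by
  obtain ⟨L, w, hL, hw, h⟩ := h
  exact ⟨L, w, hL, hw, fun h' => h (h'.symm (cov_posDef (hr.isStrictUpper hL) hw) hjK)⟩

/-- If `i` and `j` were uncorrelated given `K` at all parameters, they would be so before and after
adding `1` to `w t`. As `t` is last, this changes only the variance of `X_t` among the entries
involved, and `uncorr_erase_of_uncorr` applies. -/
theorem existsCorr_of_erase (hr : IsTopOrder G r) (ht : t ∈ K) (hjK : j ∉ K)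
    (hit : r i < r t) (hjt : r j < r t) (hK : ∀ k ∈ K, k ≠ t → r k < r t)
    {L : Matrix V V ℝ} {w : V → ℝ} (hL : ∀ u v, L u v ≠ 0 → G.Adj u v) (hw : ∀ v, 0 < w v)
    (h : ¬ (Uncorr (cov L w) i j (K.erase t) ∧
      (Uncorr (cov L w) i t (K.erase t) ∨ Uncorr (cov L w) t j (K.erase t)))) :
    ExistsCorr G i j K := by
  have hU := hr.isStrictUpper hL
  by_contra hno
  have hall : ∀ w, (∀ v, 0 < w v) → Uncorr (cov L w) i j K := by
    intro w hw
    by_contra h'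
    exact hno ⟨L, w, hL, hw, h'⟩
  refine h (uncorr_erase_of_uncorr (S' := cov L (w + Pi.single t 1)) (cov_posDef hU hw) ht
    (fun h => hit.ne (h ▸ rfl)) (fun h => hjt.ne (h ▸ rfl)) hjK (fun u hu v hv => ?_) (hall w hw)
    (hall _ fun v => ?_))
  · have key : ∀ x, x = i ∨ x = j ∨ x ∈ K → (1 - L)⁻¹ t x = if x = t then 1 else 0 := by
      intro x hx
      split_ifs with hxt
      · rw [hxt, hU.inv_apply_self]
      · refine hU.inv_apply_eq_zero_of_lt ?_
        rcases hx with rfl | rfl | hx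
        · exact hit
        · exact hjt
        · exact hK x hx hxt
    rw [cov_update, key u (by simp at hu; tauto), key v (by simp at hv; tauto)]
    by_cases hut : u = t <;> by_cases hvt : v = t <;> simp [hut, hvt]
  · rw [Pi.add_apply]
    refine add_pos_of_pos_of_nonneg (hw v) ?_
    by_cases hv : v = t
    · simp [hv]
    · simp [Pi.single_eq_of_ne hv]

/-- Let `t` be the last node among `i`, `j`, `K`. If `t = i`, the walk enters `i` from an earlier `u
∉ K`, and a correlation of `u` passes to `i`; `t = j` is symmetric. If `t ∈ K`, either `i` and `j`
stay connected given `K.erase t`, or `t` is connected to both, and one parameter correlates `t` with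
both. The summands `+ 1` matter when `t` takes the place of a node of rank zero. -/
theorem existsCorr_of_reach (hG : IsAcyclic G) (hr : IsTopOrder G r) :
    ∀ (n : ℕ) (i j : V) (K : Finset V), i ∉ K → j ∉ K →
      (r i + 1) + (r j + 1) + ∑ k ∈ K, (r k + 1) = n → ∀ s, Reach G K j s i →
      ExistsCorr G i j K := by
  intro n
  induction n using Nat.strong_induction_on with
  | _ n ih =>
    intro i j K hiK hjK hn s hs
    -- This case arises when the walk enters the last node directly from `j`.
    by_cases hij : i = j
    · subst hij
      have h0 : IsStrictUpper r (0 : Matrix V V ℝ) := fun u v h => absurd rfl h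
      exact ⟨0, 1, fun u v h => absurd rfl h, fun _ => one_pos,
        not_uncorr_self (cov_posDef h0 fun _ => one_pos)⟩
    have sink : ∀ i j, i ∉ K → j ∉ K → (r i + 1) + (r j + 1) + ∑ k ∈ K, (r k + 1) = n →
        r j < r i → (∀ k ∈ K, r k < r i) → ∀ s, Reach G K j s i → ExistsCorr G i j K := by
      intro i j hiK hjK hn hji hK s hs
      obtain ⟨s', u, hu, huK, hui⟩ := hs.exists_adj hr hji hK
      have := hr.lt hui
      obtain ⟨L, w, hL, hw, h⟩ := ih _ (by omega) u j K huK hjK rfl s' hu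
      obtain ⟨L', hL', h'⟩ := not_uncorr_replace_column hr hL hui hji hK h
      exact ⟨L', w, hL', hw, h'⟩
    obtain ⟨t, ht, hmax⟩ := Finset.exists_max_image (insert i (insert j K)) r ⟨i, by simp⟩
    have hlt : ∀ v ∈ insert i (insert j K), v ≠ t → r v < r t := fun v hv hvt =>
      lt_of_le_of_ne (hmax v hv) fun h => hvt (hr.inj h)
    simp only [Finset.mem_insert] at ht
    rcases ht with rfl | rfl | ht
    · refine sink t j hiK hjK hn (hlt j (by simp) (Ne.symm hij)) (fun k hk => ?_) s hs
      exact hlt k (by simp [hk]) fun h => hiK (h ▸ hk)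
    · obtain ⟨s', hs'⟩ := hs.symm hG hiK
      refine (sink t i hjK hiK (by omega) (hlt i (by simp) hij) (fun k hk => ?_) s' hs').symm hr hiK
      exact hlt k (by simp [hk]) fun h => hjK (h ▸ hk)
    · have hit : r i < r t := hlt i (by simp) fun h => hiK (h ▸ ht)
      have hjt : r j < r t := hlt j (by simp) fun h => hjK (h ▸ ht)
      have hK : ∀ k ∈ K, k ≠ t → r k < r t := fun k hk => hlt k (by simp [hk])
      have hsum : (r t + 1) + ∑ k ∈ K.erase t, (r k + 1) = ∑ k ∈ K, (r k + 1) :=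
        Finset.add_sum_erase K (fun k => r k + 1) ht
      have hiK' : i ∉ K.erase t := fun h => hiK (Finset.mem_of_mem_erase h)
      have hjK' : j ∉ K.erase t := fun h => hjK (Finset.mem_of_mem_erase h)
      have htK' : t ∉ K.erase t := Finset.notMem_erase t K
      have direct : ∀ s', Reach G (K.erase t) j s' i → ExistsCorr G i j K := by
        intro s' hs'
        obtain ⟨L, w, hL, hw, h⟩ := ih _ (by omega) i j (K.erase t) hiK' hjK' rfl s' hs'
        exact existsCorr_of_erase hr ht hjK hit hjt hK hL hw fun h' => h h'.1
      rcases hs.erase t with hs' | ⟨s₁, hs₁⟩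
      · exact direct _ hs'
      obtain ⟨s', hs'⟩ := hs.symm hG hiK
      rcases hs'.erase t with hs' | ⟨s₂, hs₂⟩
      · obtain ⟨s'', hs''⟩ := hs'.symm hG hjK'
        exact direct _ hs''
      · have h₁ := ih _ (by omega) t j (K.erase t) htK' hjK' rfl s₁ hs₁
        have h₂ := (ih _ (by omega) t i (K.erase t) htK' hiK' rfl s₂ hs₂).symm hr hiK'
        obtain ⟨L, w, hL, hw, h₁', h₂'⟩ := hr.exists_not_uncorr_and htK' hjK' hiK' htK' h₁ h₂
        refine existsCorr_of_erase hr ht hjK hit hjt hK hL hw ?_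
        rintro ⟨-, h | h⟩
        · exact h₂' h
        · exact h₁' h

end Completeness

/-! ### Conditional independence from an independent residual. -/

section CondIndep

variable {Ω γ β : Type*} [MeasurableSpace Ω] [MeasurableSpace γ] [MeasurableSpace β]
  {μ : Measure Ω}

/-- The kernel that sends `z` to the translate of `ν` by `ψ z`. -/
noncomputable def translateKernel (ν : Measure ℝ) (ψ : γ → ℝ) : Kernel γ ℝ :=
  (Kernel.id ×ₖ Kernel.const γ ν).map fun p => p.2 + ψ p.1

instance (ν : Measure ℝ) [IsFiniteMeasure ν] (ψ : γ → ℝ) :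
    IsFiniteKernel (translateKernel ν ψ) := by
  unfold translateKernel; infer_instance

theorem translateKernel_apply (ν : Measure ℝ) [IsFiniteMeasure ν] {ψ : γ → ℝ} (hψ : Measurable ψ)
    (z : γ) : translateKernel ν ψ z = ν.map (fun y => y + ψ z) := by
  rw [translateKernel, Kernel.map_apply _ (by fun_prop), Kernel.prod_apply, Kernel.id_apply,
    Kernel.const_apply, Measure.dirac_prod, Measure.map_map (by fun_prop) (by fun_prop)]
  rfl

/-- The shear `(z, y) ↦ (z, y + ψ z)`. -/
def shear (ψ : γ → ℝ) (hψ : Measurable ψ) : γ × ℝ ≃ᵐ γ × ℝ where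
  toFun p := (p.1, p.2 + ψ p.1)
  invFun p := (p.1, p.2 - ψ p.1)
  left_inv p := by simp
  right_inv p := by simp
  measurable_toFun := by
    change Measurable fun p : γ × ℝ => (p.1, p.2 + ψ p.1)
    fun_prop
  measurable_invFun := by
    change Measurable fun p : γ × ℝ => (p.1, p.2 - ψ p.1)
    fun_prop

theorem map_shear_prod (m : Measure γ) [IsFiniteMeasure m] (ν : Measure ℝ) [IsFiniteMeasure ν]
    {ψ : γ → ℝ} (hψ : Measurable ψ) :
    (m.prod ν).map (shear ψ hψ) = m ⊗ₘ translateKernel ν ψ := by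
  ext s hs
  rw [Measure.map_apply (shear ψ hψ).measurable hs,
    Measure.prod_apply ((shear ψ hψ).measurable hs), Measure.compProd_apply hs]
  refine lintegral_congr fun z => ?_
  rw [translateKernel_apply ν hψ, Measure.map_apply (by fun_prop) (measurable_prodMk_left hs)]
  rfl

/-- Independence says that the joint law is a product; push both sides forward along the invertible
shear. -/
theorem indepFun_iff_map_add_eq_compProd [IsFiniteMeasure μ] {W : Ω → γ} {Y : Ω → ℝ} {ψ : γ → ℝ}
    (hW : Measurable W) (hY : Measurable Y) (hψ : Measurable ψ) :
    IndepFun W Y μ ↔ μ.map (fun ω => (W ω, Y ω + ψ (W ω))) =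
      μ.map W ⊗ₘ translateKernel (μ.map Y) ψ := by
  rw [indepFun_iff_map_prod_eq_prod_map_map hW.aemeasurable hY.aemeasurable,
    ← map_shear_prod _ _ hψ, ← (shear ψ hψ).map_measurableEquiv_injective.eq_iff,
    Measure.map_map (shear ψ hψ).measurable (by fun_prop)]
  rfl

/-- Given `Z`, the variable `Y + ψ(Z)` has as its law the translate of the law of `Y` by `ψ(Z)`.
Conditional independence says that the law given `(Z, X)` is the same translate, that is, `Y` is
independent of `(Z, X)`. -/
theorem condIndepFun_add_iff_indepFun [StandardBorelSpace Ω] [IsFiniteMeasure μ]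
    [StandardBorelSpace β] [Nonempty β] {Z : Ω → γ} {X : Ω → β} {Y : Ω → ℝ} {ψ : γ → ℝ}
    (hZ : Measurable Z) (hX : Measurable X) (hY : Measurable Y) (hψ : Measurable ψ)
    (hZY : IndepFun Z Y μ) :
    X ⟂ᵢ[Z, hZ; μ] (fun ω => Y ω + ψ (Z ω)) ↔ IndepFun (fun ω => (Z ω, X ω)) Y μ := by
  have hf : Measurable fun ω => Y ω + ψ (Z ω) := by fun_prop
  have hψ' : Measurable fun p : γ × β => ψ p.1 := by fun_prop
  rw [condIndepFun_iff_condDistrib_prod_ae_eq_prodMkRight hf hX hZ,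
    indepFun_iff_map_add_eq_compProd (hZ.prodMk hX) hY hψ',
    ← condDistrib_ae_eq_iff_measure_eq_compProd _ hf.aemeasurable]
  have h0 : condDistrib (fun ω => Y ω + ψ (Z ω)) Z μ =ᵐ[μ.map Z]
      translateKernel (μ.map Y) ψ := by
    rw [condDistrib_ae_eq_iff_measure_eq_compProd _ hf.aemeasurable]
    exact (indepFun_iff_map_add_eq_compProd hZ hY hψ).1 hZY
  have h1 : (condDistrib (fun ω => Y ω + ψ (Z ω)) Z μ).prodMkRight β
      =ᵐ[μ.map fun ω => (Z ω, X ω)] translateKernel (μ.map Y) fun p : γ × β => ψ p.1 := by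
    have hmap : μ.map Z = (μ.map fun ω => (Z ω, X ω)).map Prod.fst := by
      rw [Measure.map_map measurable_fst (hZ.prodMk hX)]; rfl
    rw [hmap] at h0
    filter_upwards [ae_of_ae_map measurable_fst.aemeasurable h0] with p hp
    rw [Kernel.prodMkRight_apply, hp, translateKernel_apply _ hψ, translateKernel_apply _ hψ']
  exact ⟨fun h => h.trans h1, fun h => h.trans h1.symm⟩

end CondIndep

/-! ### Gaussian conditional independence. -/

section Gaussian

open Matrix

variable {V : Type*} [Fintype V] [DecidableEq V] {S : Matrix V V ℝ} {i j : V} {K : Finset V}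

theorem covariance_eval_sum (hS : S.PosDef) (x : V → ℝ) (u : V) :
    cov[fun X : EuclideanSpace ℝ V => X u, fun X => ∑ v, x v * X v;
      multivariateGaussian 0 S] = (S *ᵥ x) u := by
  have hmem : ∀ v, MemLp (fun X : EuclideanSpace ℝ V => X v) 2 (multivariateGaussian 0 S) :=
    fun v => (IsGaussian.hasGaussianLaw_id.map_fun (EuclideanSpace.proj v : _ →L[ℝ] ℝ)).memLp_two
  rw [covariance_fun_sum_right (fun v => (hmem v).const_mul _) (hmem u)]
  simp only [mulVec, dotProduct]
  refine Finset.sum_congr rfl fun v _ => ?_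
  rw [covariance_const_mul_right, covariance_eval_multivariateGaussian hS.posSemidef, mul_comm]

theorem indepFun_of_mulVec_eq_zero (hS : S.PosDef) {x : V → ℝ} {ι : Type*} [Finite ι] {c : ι → V}
    (h : ∀ t, (S *ᵥ x) (c t) = 0) :
    IndepFun (fun (X : EuclideanSpace ℝ V) t => X (c t)) (fun X => ∑ v, x v * X v)
      (multivariateGaussian 0 S) := by
  have := Fintype.ofFinite ι
  -- The scalar combination is treated as a family over `Unit`, since the Gaussian criterion
  -- compares two families.
  let L : EuclideanSpace ℝ V →L[ℝ] (ι → ℝ) × (Unit → ℝ) :=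
    (ContinuousLinearMap.pi fun t => EuclideanSpace.proj (c t)).prod
      (ContinuousLinearMap.pi fun _ => ∑ v, x v • EuclideanSpace.proj v)
  have hL : HasGaussianLaw (fun X : EuclideanSpace ℝ V =>
      ((fun t => X (c t) : ι → ℝ), (fun _ => ∑ v, x v * X v : Unit → ℝ)))
      (multivariateGaussian 0 S) := by
    have := (IsGaussian.hasGaussianLaw_id (μ := multivariateGaussian 0 S)).map_fun L
    have hfun : (fun X : EuclideanSpace ℝ V =>
        ((fun t => X (c t) : ι → ℝ), (fun _ => ∑ v, x v * X v : Unit → ℝ))) =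
        fun X => L (id X) := by
      funext X
      ext <;> simp [L]
    rw [hfun]
    exact this
  have := hL.indepFun_of_covariance_eval (X := fun t (X : EuclideanSpace ℝ V) => X (c t))
    (Y := fun _ X => ∑ v, x v * X v) fun t _ => by rw [covariance_eval_sum hS, h]
  exact this.comp measurable_id (measurable_pi_apply ())

theorem mulVec_eq_zero_of_indepFun (hS : S.PosDef) {x : V → ℝ} {u : V}
    (h : IndepFun (fun X : EuclideanSpace ℝ V => X u) (fun X => ∑ v, x v * X v)
      (multivariateGaussian 0 S)) : (S *ᵥ x) u = 0 := by
  have hmem : ∀ v, MemLp (fun X : EuclideanSpace ℝ V => X v) 2 (multivariateGaussian 0 S) :=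
    fun v => (IsGaussian.hasGaussianLaw_id.map_fun (EuclideanSpace.proj v : _ →L[ℝ] ℝ)).memLp_two
  rw [← covariance_eval_sum hS]
  exact h.covariance_eq_zero (hmem u)
    (memLp_finsetSum _ fun v _ => (hmem v).const_mul (x v))

/-- Write `X_j` as its residual on `X_K` plus a linear function of `X_K`. The residual is
independent of `X_K`, so the condition becomes its independence of `(X_K, X_i)`, which for Gaussians
means zero covariance. -/
theorem gaussianCI_iff_uncorr (hS : S.PosDef) (hjK : j ∉ K) :
    GaussianCI S i j K ↔ Uncorr S i j K := by
  have main : ∀ x : V → ℝ, x j = 1 → (∀ v, v ∉ insert j K → x v = 0) →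
      (∀ v ∈ K, (S *ᵥ x) v = 0) → (GaussianCI S i j K ↔ (S *ᵥ x) i = 0) := by
    intro x hxj hx hSx
    set Z : EuclideanSpace ℝ V → K → ℝ := fun X k => X k with hZdef
    set Y : EuclideanSpace ℝ V → ℝ := fun X => ∑ v, x v * X v with hYdef
    have hZ : Measurable Z := measurable_coords K
    have hXm : ∀ u, Measurable fun X : EuclideanSpace ℝ V => X u := fun u => by fun_prop
    have hY : Measurable Y := by fun_prop
    set ψ : (K → ℝ) → ℝ := fun z => - ∑ k : K, x k * z k with hψdef
    have hψ : Measurable ψ := by fun_prop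
    have hXj : (fun X : EuclideanSpace ℝ V => X j) = fun X => Y X + ψ (Z X) := by
      funext X
      simp only [hYdef, hψdef, hZdef]
      rw [Finset.sum_coe_sort K (fun k => x k * X k),
        ← Finset.sum_subset (Finset.subset_univ (insert j K)) fun v _ hv => by
          rw [hx v hv, zero_mul], Finset.sum_insert hjK, hxj]
      ring
    have hZY : IndepFun Z Y (multivariateGaussian 0 S) :=
      indepFun_of_mulVec_eq_zero hS fun k : K => hSx k k.2
    have hCI : GaussianCI S i j K ↔
        IndepFun (fun X : EuclideanSpace ℝ V => (Z X, X i)) Y (multivariateGaussian 0 S) := by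
      rw [← condIndepFun_add_iff_indepFun hZ (hXm i) hY hψ hZY, ← hXj]
      rfl
    rw [hCI]
    constructor
    · intro h
      exact mulVec_eq_zero_of_indepFun hS (h.comp measurable_snd measurable_id)
    · intro h
      have h' := indepFun_of_mulVec_eq_zero hS (x := x)
        (c := fun a : Option K => a.elim i Subtype.val) (fun a => by
          cases a with
          | none => exact h
          | some k => exact hSx k k.2)
      have hm : Measurable fun z : Option K → ℝ => ((fun k : K => z (some k)), z none) := by
        fun_prop
      exact h'.comp hm measurable_id
  constructor
  · intro h
    obtain ⟨x, hxj, hx, hSx⟩ := exists_residual hS hjK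
    refine ⟨x, hxj, hx, fun v hv => ?_⟩
    rcases Finset.mem_insert.1 hv with rfl | hv
    · exact (main x hxj hx hSx).1 h
    · exact hSx v hv
  · rintro ⟨x, hxj, hx, hSx⟩
    exact (main x hxj hx fun v hv => hSx v (Finset.mem_insert_of_mem hv)).2
      (hSx i (Finset.mem_insert_self _ _))

end Gaussian

/-! ### Zariski closures and irreducibility. -/

section Zariski

open MvPolynomial

variable {τ : Type*}

theorem subset_zariskiClosure (S : Set (τ → ℝ)) : S ⊆ zariskiClosure S :=
  fun x hx _ hp => hp x hx

theorem zariskiClosure_mono {S T : Set (τ → ℝ)} (h : S ⊆ T) : zariskiClosure S ⊆ zariskiClosure T :=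
  fun _ hx p hp => hx p fun y hy => hp y (h hy)

theorem isVariety_zariskiClosure (S : Set (τ → ℝ)) : IsVariety (zariskiClosure S) := ⟨_, rfl⟩

theorem IsVariety.inter_zero {Z : Set (τ → ℝ)} (hZ : IsVariety Z) (q : MvPolynomial τ ℝ) :
    IsVariety {x ∈ Z | aeval x q = 0} := by
  obtain ⟨I, rfl⟩ := hZ
  refine ⟨I ⊔ Ideal.span {q}, ?_⟩
  ext x
  constructor
  · rintro ⟨hx, hq⟩ p hp
    obtain ⟨a, ha, b, hb, rfl⟩ := Submodule.mem_sup.1 hp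
    obtain ⟨c, rfl⟩ := Ideal.mem_span_singleton'.1 hb
    rw [map_add, map_mul, hq, mul_zero, add_zero]
    exact hx a ha
  · intro hx
    exact ⟨fun p hp => hx p (Ideal.mem_sup_left hp),
      hx q (Ideal.mem_sup_right (Ideal.mem_span_singleton_self q))⟩

theorem IsIrreducibleVariety.forall_zero_or {Z : Set (τ → ℝ)} (hZ : IsIrreducibleVariety Z)
    {p q : MvPolynomial τ ℝ} (h : ∀ x ∈ Z, aeval x p * aeval x q = 0) :
    (∀ x ∈ Z, aeval x p = 0) ∨ ∀ x ∈ Z, aeval x q = 0 := by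
  have := hZ.2.2 _ _ (hZ.1.inter_zero p) (hZ.1.inter_zero q) (by
    ext x
    constructor
    · intro hx
      exact (mul_eq_zero.1 (h x hx)).imp (fun h => ⟨hx, h⟩) fun h => ⟨hx, h⟩
    · rintro (hx | hx) <;> exact hx.1)
  refine this.imp (fun h x hx => ?_) fun h x hx => ?_ <;>
  · rw [h] at hx
    exact hx.2

/-- The Zariski closure of `S` is irreducible if the vanishing ideal of `S` is prime. -/
theorem isIrreducibleVariety_zariskiClosure {S : Set (τ → ℝ)} (hS : S.Nonempty)
    (h : ∀ p q : MvPolynomial τ ℝ, (∀ x ∈ S, aeval x p * aeval x q = 0) →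
      (∀ x ∈ S, aeval x p = 0) ∨ ∀ x ∈ S, aeval x q = 0) :
    IsIrreducibleVariety (zariskiClosure S) := by
  refine ⟨isVariety_zariskiClosure S, hS.mono (subset_zariskiClosure S), ?_⟩
  rintro _ _ ⟨I, rfl⟩ ⟨J, rfl⟩ hIJ
  have key : ∀ I : Ideal (MvPolynomial τ ℝ), zeroLocus ℝ I ⊆ zariskiClosure S →
      zariskiClosure S ≠ zeroLocus ℝ I → ∃ p ∈ I, ∃ x ∈ S, aeval x p ≠ 0 := by
    intro I hI hne
    by_contra! h'
    refine hne (Set.Subset.antisymm (fun x hx p hp => hx p (h' p hp)) hI)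
  by_contra! hne
  obtain ⟨p, hp, x, hx, hpx⟩ := key I (hIJ ▸ Set.subset_union_left) hne.1
  obtain ⟨q, hq, y, hy, hqy⟩ := key J (hIJ ▸ Set.subset_union_right) hne.2
  have := h p q fun z hz => by
    have hz' := subset_zariskiClosure S hz
    rw [hIJ] at hz'
    rcases hz' with hz' | hz'
    · rw [hz' p hp, zero_mul]
    · rw [hz' q hq, mul_zero]
  rcases this with h' | h'
  · exact hpx (h' x hx)
  · exact hqy (h' y hy)

theorem X_dvd_sub_aeval [DecidableEq τ] (s : τ) (f : MvPolynomial τ ℝ) :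
    (X s : MvPolynomial τ ℝ) ∣ f - aeval (fun t => if t = s then 0 else X t) f := by
  induction f using MvPolynomial.induction_on with
  | C a => simp
  | add p q hp hq =>
    rw [map_add, add_sub_add_comm]
    exact dvd_add hp hq
  | mul_X p t hp =>
    rw [map_mul, aeval_X]
    split_ifs with h
    · rw [mul_zero, sub_zero, h]
      exact dvd_mul_left _ _
    · rw [← sub_mul]
      exact hp.mul_right _

end Zariski

/-! ### The rational inverse of the parametrization. -/

section Model

open Matrix

variable {V : Type*} [Fintype V] [DecidableEq V] {R : Type*} [CommRing R]
  {G : Digraph V} {r : V → ℕ}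

theorem dagModel_subset_posDefCone (hr : IsTopOrder G r) : dagModel G ⊆ posDefCone V := by
  rintro _ ⟨l, w, hw, rfl⟩
  exact cov_posDef (hr.isStrictUpper_edgeMatrix l) hw

theorem dagModel_nonempty (G : Digraph V) : (dagModel G).Nonempty :=
  ⟨_, 0, 1, fun _ => one_pos, rfl⟩

/-- The vanishing ideal of the model is the kernel of `paramPullback G`, a map into a domain. -/
theorem isIrreducibleVariety_dagModel (hr : IsTopOrder G r) :
    IsIrreducibleVariety (zariskiClosure (dagModel G)) := by
  refine isIrreducibleVariety_zariskiClosure (dagModel_nonempty G) fun p q h => ?_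
  have key : ∀ p : MvPolynomial (Sym2 V) ℝ, paramPullback G p = 0 →
      ∀ x ∈ dagModel G, MvPolynomial.aeval x p = 0 := by
    rintro p hp _ ⟨l, w, hw, rfl⟩
    rw [← hr.aeval_paramPullback, hp, map_zero]
  have hpq : paramPullback G p * paramPullback G q = 0 := by
    by_contra hne
    obtain ⟨l, w, hw, hlw⟩ := exists_pos_aeval_ne_zero hne
    rw [map_mul, hr.aeval_paramPullback, hr.aeval_paramPullback] at hlw
    exact hlw (h _ ⟨l, w, hw, rfl⟩)
  exact (mul_eq_zero.1 hpq).imp (key p) (key q)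

/-- The submatrix of `S` on the nodes that precede `v`. -/
def predMatrix (r : V → ℕ) (S : Matrix V V R) (v : V) :
    Matrix {u // r u < r v} {u // r u < r v} R :=
  S.submatrix Subtype.val Subtype.val

/-- The numerators in Cramer's rule for the regression of `v` on the nodes that precede it. -/
def predNum (r : V → ℕ) (S : Matrix V V R) (v : V) : {u // r u < r v} → R :=
  (predMatrix r S v).adjugate *ᵥ fun u => S u v

theorem predMatrix_map {R' : Type*} [CommRing R'] (f : R →+* R') (S : Matrix V V R) (v : V) :
    f (predMatrix r S v).det = (predMatrix r (S.map f) v).det := by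
  rw [RingHom.map_det]; rfl

theorem predNum_map {R' : Type*} [CommRing R'] (f : R →+* R') (S : Matrix V V R) (v : V)
    (u : {u // r u < r v}) : f (predNum r S v u) = predNum r (S.map f) v u := by
  have h := RingHom.map_adjugate f (predMatrix r S v)
  rw [predNum, RingHom.map_mulVec, ← RingHom.mapMatrix_apply, h]
  rfl

theorem sum_pred {v : V} {f : V → R} (hf : ∀ u, f u ≠ 0 → r u < r v) :
    ∑ u : {u // r u < r v}, f u = ∑ u, f u := by
  rw [← Finset.sum_subtype (Finset.univ.filter fun u => r u < r v) (by simp) f,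
    Finset.sum_filter_of_ne fun u _ hu => hf u hu]

theorem predMatrix_mulVec {L : Matrix V V R} (hL : IsStrictUpper r L) (S : Matrix V V R) {u v : V} :
    ∑ q : {q // r q < r v}, S u q * L q v = S u v - (S * (1 - L)) u v := by
  rw [sum_pred (f := fun q => S u q * L q v) fun q hq => hL q v (right_ne_zero_of_mul hq),
    mul_sub, mul_one, Matrix.sub_apply, sub_sub_cancel, mul_apply]

/-- The error at `v` is uncorrelated with all predecessors of `v`, so column `v` of `L` solves the
normal equations; multiply by the adjugate. -/
theorem predNum_cov {L : Matrix V V R} {w : V → R} (hL : IsStrictUpper r L) (v : V)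
    (u : {u // r u < r v}) :
    predNum r (cov L w) v u = (predMatrix r (cov L w) v).det * L u v := by
  have h : predMatrix r (cov L w) v *ᵥ (fun q => L q v) = fun u : {u // r u < r v} => cov L w u v := by
    funext u
    have := predMatrix_mulVec hL (cov L w) (u := u) (v := v)
    rw [hL.cov_mul, mul_diagonal, transpose_apply, hL.inv_apply_eq_zero_of_lt u.2, zero_mul,
      sub_zero] at this
    exact this
  rw [predNum, ← h, mulVec_mulVec, adjugate_mul, smul_mulVec, one_mulVec]
  rfl

theorem variance_cov {L : Matrix V V R} {w : V → R} (hL : IsStrictUpper r L) (v : V) :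
    (predMatrix r (cov L w) v).det * w v = (predMatrix r (cov L w) v).det * cov L w v v -
      ∑ q : {q // r q < r v}, cov L w v q * predNum r (cov L w) v q := by
  have := predMatrix_mulVec hL (cov L w) (u := v) (v := v)
  rw [hL.cov_mul, mul_diagonal, transpose_apply, hL.inv_apply_self, one_mul] at this
  have h : w v = cov L w v v - ∑ q : {q // r q < r v}, cov L w v q * L q v := by
    rw [this]; ring
  rw [h, mul_sub, Finset.mul_sum]
  congr 1
  refine Finset.sum_congr rfl fun q _ => ?_
  rw [predNum_cov hL]
  ring

theorem det_predMatrix_pos {S : Matrix V V ℝ} (hS : S.PosDef) (v : V) :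
    0 < (predMatrix r S v).det :=
  (hS.submatrix Subtype.val_injective).det_pos

/-- The generic symmetric matrix. -/
noncomputable def genericMatrix (V : Type*) : Matrix V V (MvPolynomial (Sym2 V) ℝ) :=
  symMatrix MvPolynomial.X

theorem genericMatrix_map (x : Sym2 V → ℝ) :
    (genericMatrix V).map (MvPolynomial.aeval (R := ℝ) x).toRingHom = symMatrix x := by
  ext u v
  simp [genericMatrix, symMatrix]

theorem aeval_predDet (x : Sym2 V → ℝ) (v : V) :
    MvPolynomial.aeval x (predMatrix r (genericMatrix V) v).det =
      (predMatrix r (symMatrix x) v).det := by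
  rw [← genericMatrix_map x, ← predMatrix_map]; rfl

theorem aeval_predNum (x : Sym2 V → ℝ) (v : V) (u : {u // r u < r v}) :
    MvPolynomial.aeval x (predNum r (genericMatrix V) v u) = predNum r (symMatrix x) v u := by
  rw [← genericMatrix_map x, ← predNum_map]; rfl

/-- Regression on predecessors defines `L` for any positive definite `S`, with `(1 - L)ᵀ S (1 - L)`
diagonal and positive. For a nonedge the numerator of `L u v` is a polynomial that vanishes on the
model, hence on its closure. -/
theorem zariskiClosure_dagModel_inter_posDefCone (hr : IsTopOrder G r) :
    zariskiClosure (dagModel G) ∩ posDefCone V = dagModel G := by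
  refine Set.Subset.antisymm ?_ fun x hx =>
    ⟨subset_zariskiClosure _ hx, dagModel_subset_posDefCone hr hx⟩
  rintro x ⟨hx, hS⟩
  change (symMatrix x).PosDef at hS
  set S := symMatrix x with hSdef
  set L : Matrix V V ℝ := Matrix.of fun u v =>
    if h : r u < r v then ((predMatrix r S v).det)⁻¹ * predNum r S v ⟨u, h⟩ else 0 with hLdef
  have hLG : ∀ u v, L u v ≠ 0 → G.Adj u v := by
    intro u v huv
    by_contra hadj
    by_cases h : r u < r v
    · refine huv ?_
      have : predNum r S v ⟨u, h⟩ = 0 := by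
        rw [hSdef, ← aeval_predNum]
        refine hx _ ?_
        rintro _ ⟨l, w, hw, rfl⟩
        rw [aeval_predNum, symMatrix_param, predNum_cov (hr.isStrictUpper_edgeMatrix l)]
        simp [edgeMatrix_of_not_adj l hadj]
      simp [hLdef, this]
    · simp [hLdef, h] at huv
  have hL := hr.isStrictUpper hLG
  have hSL : ∀ u v, r u < r v → (S * (1 - L)) u v = 0 := by
    intro u v huv
    have hcol : predMatrix r S v *ᵥ (fun q => L q v) = fun u : {u // r u < r v} => S u v := by
      have : (fun q : {q // r q < r v} => L q v) = ((predMatrix r S v).det)⁻¹ • predNum r S v := by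
        funext q
        simp [hLdef, q.2]
      rw [this, mulVec_smul, predNum, mulVec_mulVec, mul_adjugate, smul_mulVec, one_mulVec,
        smul_smul, inv_mul_cancel₀ (det_predMatrix_pos hS v).ne', one_smul]
    have h1 := congrFun hcol ⟨u, huv⟩
    have h2 := predMatrix_mulVec hL S (u := u) (v := v)
    have h3 : ∑ q : {q // r q < r v}, S u q * L q v = S u v := h1
    rw [h3] at h2
    linarith
  set D := (1 - L)ᵀ * S * (1 - L) with hD
  have hDpos : D.PosDef := by
    have h := hS.conjTranspose_mul_mul_same (B := 1 - L)
      (mulVec_injective_of_isUnit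
        ((isUnit_iff_isUnit_det _).2 (by rw [hL.det_one_sub]; exact isUnit_one)))
    simpa [hD] using h
  have hDlt : ∀ u v, r u < r v → D u v = 0 := by
    intro u v huv
    rw [hD, Matrix.mul_assoc, mul_apply]
    refine Finset.sum_eq_zero fun q _ => ?_
    by_cases hq : r q < r v
    · rw [hSL q v hq, mul_zero]
    · have hqu : q ≠ u := fun h => hq (h ▸ huv)
      have : L q u = 0 := by
        by_contra h
        exact hq ((hL q u h).trans huv)
      rw [transpose_apply, Matrix.sub_apply, one_apply_ne hqu, this, sub_zero, zero_mul]
  have hDsymm : D.IsSymm := by simpa using hDpos.1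
  have hDdiag : D = diagonal fun v => D v v := by
    ext u v
    by_cases huv : u = v
    · rw [huv, diagonal_apply_eq]
    · rw [diagonal_apply_ne _ huv]
      rcases lt_or_gt_of_ne fun h => huv (hr.inj h) with h | h
      · exact hDlt u v h
      · rw [← hDsymm.apply]
        exact hDlt v u h
  exact mem_dagModel_iff.2 ⟨L, fun v => D v v, hLG, fun v => hDpos.diag_pos,
    hL.eq_cov_of_transpose_mul_mul hDdiag⟩

/-- Every polynomial in the parameters is, up to a denominator that does not vanish on positive
definite matrices, a polynomial in the covariance matrix. -/
theorem exists_clear_denominators (hr : IsTopOrder G r) (g : MvPolynomial (Edge G ⊕ V) ℝ) :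
    ∃ (h : MvPolynomial (Sym2 V) ℝ) (n : ℕ), ∀ (l : Edge G → ℝ) (w : V → ℝ),
      MvPolynomial.aeval (param G l w) h =
        (∏ v, (predMatrix r (symMatrix (param G l w)) v).det) ^ n *
          MvPolynomial.aeval (Sum.elim l w) g := by
  set d : MvPolynomial (Sym2 V) ℝ := ∏ v, (predMatrix r (genericMatrix V) v).det with hd
  have hdx : ∀ x : Sym2 V → ℝ, MvPolynomial.aeval x d = ∏ v, (predMatrix r (symMatrix x) v).det := by
    intro x
    rw [hd, map_prod]
    exact Finset.prod_congr rfl fun v _ => aeval_predDet x v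
  have hvar : ∀ s : Edge G ⊕ V, ∃ h : MvPolynomial (Sym2 V) ℝ, ∀ (l : Edge G → ℝ) (w : V → ℝ),
      MvPolynomial.aeval (param G l w) h =
        MvPolynomial.aeval (param G l w) d * Sum.elim l w s := by
    have hclear : ∀ (v : V) (t : MvPolynomial (Sym2 V) ℝ) (s : Edge G ⊕ V),
        (∀ (l : Edge G → ℝ) (w : V → ℝ), MvPolynomial.aeval (param G l w) t =
          (predMatrix r (symMatrix (param G l w)) v).det * Sum.elim l w s) →
        ∃ h : MvPolynomial (Sym2 V) ℝ, ∀ (l : Edge G → ℝ) (w : V → ℝ),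
          MvPolynomial.aeval (param G l w) h =
            MvPolynomial.aeval (param G l w) d * Sum.elim l w s := by
      intro v t s ht
      refine ⟨(∏ u ∈ Finset.univ.erase v, (predMatrix r (genericMatrix V) u).det) * t,
        fun l w => ?_⟩
      rw [hd, ← Finset.mul_prod_erase Finset.univ _ (Finset.mem_univ v), map_mul, map_mul, ht,
        aeval_predDet]
      ring
    rintro (⟨⟨u, v⟩, huv⟩ | v)
    · refine hclear v (predNum r (genericMatrix V) v ⟨u, hr.lt huv⟩) _ fun l w => ?_
      rw [aeval_predNum, symMatrix_param, predNum_cov (hr.isStrictUpper_edgeMatrix l),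
        edgeMatrix_of_adj l huv]
      rfl
    · refine hclear v ((predMatrix r (genericMatrix V) v).det * genericMatrix V v v -
        ∑ q : {q // r q < r v}, genericMatrix V v q * predNum r (genericMatrix V) v q) _
        fun l w => ?_
      have hX : ∀ u v, MvPolynomial.aeval (param G l w) (genericMatrix V u v) =
          cov (edgeMatrix G l) w u v := fun u v => by
        rw [← symMatrix_param]; simp [genericMatrix, symMatrix]
      rw [map_sub, map_mul, map_sum, aeval_predDet, hX, symMatrix_param, Sum.elim_inr,
        variance_cov (hr.isStrictUpper_edgeMatrix l)]
      congr 1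
      refine Finset.sum_congr rfl fun q _ => ?_
      rw [map_mul, hX, aeval_predNum, symMatrix_param]
  simp only [← hdx]
  induction g using MvPolynomial.induction_on with
  | C a => exact ⟨MvPolynomial.C a, 0, fun l w => by simp⟩
  | add p q hp hq =>
    obtain ⟨h₁, n₁, H₁⟩ := hp
    obtain ⟨h₂, n₂, H₂⟩ := hq
    refine ⟨h₁ * d ^ n₂ + h₂ * d ^ n₁, n₁ + n₂, fun l w => ?_⟩
    rw [map_add, map_mul, map_mul, map_pow, map_pow, H₁, H₂, map_add]
    ring
  | mul_X p s hp =>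
    obtain ⟨h₁, n₁, H₁⟩ := hp
    obtain ⟨h₂, H₂⟩ := hvar s
    refine ⟨h₁ * h₂, n₁ + 1, fun l w => ?_⟩
    rw [map_mul, map_mul, H₁, H₂, MvPolynomial.aeval_X]
    ring

variable {a b : V}

/-- Modulo the variable, `f` is its restriction to the hyperplane, which is zero because it vanishes
at all positive parameters. -/
theorem X_inl_dvd (hab : G.Adj a b) {f : MvPolynomial (Edge G ⊕ V) ℝ}
    (h : ∀ (l : Edge G → ℝ) (w : V → ℝ), (∀ v, 0 < w v) → l ⟨(a, b), hab⟩ = 0 →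
      MvPolynomial.aeval (Sum.elim l w) f = 0) :
    (MvPolynomial.X (Sum.inl ⟨(a, b), hab⟩) : MvPolynomial (Edge G ⊕ V) ℝ) ∣ f := by
  classical
  have hdvd := X_dvd_sub_aeval (Sum.inl ⟨(a, b), hab⟩ : Edge G ⊕ V) f
  set f' := MvPolynomial.aeval (fun t => if t = (Sum.inl ⟨(a, b), hab⟩ : Edge G ⊕ V) then 0 else
    (MvPolynomial.X t : MvPolynomial (Edge G ⊕ V) ℝ)) f with hf'
  have : f' = 0 := by
    by_contra hne
    obtain ⟨l, w, hw, hlw⟩ := exists_pos_aeval_ne_zero hne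
    refine hlw ?_
    rw [hf', ← AlgHom.comp_apply, MvPolynomial.comp_aeval]
    have := h (Function.update l ⟨(a, b), hab⟩ 0) w hw (by simp)
    convert this using 3
    funext t
    rcases t with e | v
    · by_cases he : e = ⟨(a, b), hab⟩
      · simp [he]
      · simp [he]
    · simp
  rwa [this, sub_zero] at hdvd

theorem adj_deleteEdge_of_edgeMatrix_ne_zero (hab : G.Adj a b) {l : Edge G → R}
    (hl : l ⟨(a, b), hab⟩ = 0) {u v : V} (h : edgeMatrix G l u v ≠ 0) :
    (deleteEdge G a b).Adj u v := by
  refine ⟨adj_of_edgeMatrix_ne_zero h, ?_⟩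
  rintro ⟨rfl, rfl⟩
  exact h (by rw [edgeMatrix_of_adj l hab, hl])

theorem IsTopOrder.deleteEdge (hr : IsTopOrder G r) (a b : V) :
    IsTopOrder (GaussianDAG.deleteEdge G a b) r :=
  ⟨hr.inj, fun h => hr.lt h.1⟩

end Model

end GaussianDAG

/-! ### The theorem. -/

theorem mainTheorem6 {V : Type*} [Fintype V] [DecidableEq V]
    (G : Digraph V) (hG : GaussianDAG.IsAcyclic G)
    (i j : V) (K : Finset V) (hij : i ≠ j) (hiK : i ∉ K) (hjK : j ∉ K)
    (hsep : ¬ GaussianDAG.DSeparates G K i j)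
    (a b : V) (hab : G.Adj a b)
    (huse : ∀ p : List V, GaussianDAG.IsDConnectingPath G K i j p → GaussianDAG.UsesEdge p a b) :
    (MvPolynomial.X (Sum.inl ⟨(a, b), hab⟩) : MvPolynomial (GaussianDAG.Edge G ⊕ V) ℝ) ∣
        GaussianDAG.paramPullback G (GaussianDAG.minorPoly i j K) ∧
      GaussianDAG.IsModelComponent
        (GaussianDAG.zariskiClosure (GaussianDAG.dagModel (GaussianDAG.deleteEdge G a b)))
        (GaussianDAG.dagModel G ∩ GaussianDAG.ciModel i j K) ∧
      GaussianDAG.zariskiClosure (GaussianDAG.dagModel (GaussianDAG.deleteEdge G a b)) ∩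
          GaussianDAG.posDefCone V =
        GaussianDAG.dagModel (GaussianDAG.deleteEdge G a b) := by
  open GaussianDAG in
  obtain ⟨r, hr⟩ := exists_isTopOrder hG
  have hr' := hr.deleteEdge a b
  have hclosure := zariskiClosure_dagModel_inter_posDefCone hr'
  have hsound : ∀ (L : Matrix V V ℝ) (w : V → ℝ),
      (∀ u v, L u v ≠ 0 → (deleteEdge G a b).Adj u v) → (∀ v, 0 < w v) →
      Uncorr (cov L w) i j K := by
    intro L w hL hw
    have hS := cov_posDef (hr'.isStrictUpper hL) hw
    exact (uncorr_of_not_reach hr' hiK hjK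
      (not_reach_of_dSeparates (hG.deleteEdge a b) (dSeparates_deleteEdge hG hab huse))
      hL hw).symm hS hjK
  have haeval : ∀ (l : Edge G → ℝ) (w : V → ℝ), (∀ v, 0 < w v) →
      (MvPolynomial.aeval (Sum.elim l w) (paramPullback G (minorPoly i j K)) = 0 ↔
        Uncorr (cov (edgeMatrix G l) w) i j K) := by
    intro l w hw
    rw [hr.aeval_paramPullback, aeval_minorPoly, symMatrix_param]
    exact det_minor_eq_zero_iff (cov_posDef (hr.isStrictUpper_edgeMatrix l) hw) hiK hjK
  refine ⟨X_inl_dvd hab fun l w hw hl => (haeval l w hw).2 ?_, ⟨?_, ?_⟩, hclosure⟩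
  · exact hsound _ w (fun u v h => adj_deleteEdge_of_edgeMatrix_ne_zero hab hl h) hw
  · have hsub : dagModel (deleteEdge G a b) ⊆ dagModel G ∩ ciModel i j K := by
      intro x hx
      have hS : (symMatrix x).PosDef := dagModel_subset_posDefCone hr' hx
      obtain ⟨L, w, hL, hw, hxL⟩ := mem_dagModel_iff.1 hx
      refine ⟨mem_dagModel_iff.2 ⟨L, w, fun u v h => (hL u v h).1, hw, hxL⟩, hS, ?_⟩
      rw [gaussianCI_iff_uncorr hS hjK, hxL]
      exact hsound L w hL hw
    refine ⟨⟨isIrreducibleVariety_dagModel hr', zariskiClosure_mono hsub⟩, ?_⟩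
    -- Maximality: a polynomial `q` that vanishes on the smaller model has to vanish at every `x ∈
    -- Z`.
    rintro Z ⟨hZ, hZY⟩ hWZ x hx q hq
    obtain ⟨s, hs⟩ := exists_reach_of_not_dSeparates hG hjK hsep
    have hf : paramPullback G (minorPoly i j K) ≠ 0 :=
      (hr.paramPullback_minorPoly_ne_zero_iff hiK hjK).2
        (existsCorr_of_reach hG hr _ i j K hiK hjK rfl s hs)
    -- Completeness is needed here: only a nonzero pullback has a finite multiplicity of `λ_ab`.
    obtain ⟨g, hfg, hg⟩ := (FiniteMultiplicity.of_not_isUnit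
      (MvPolynomial.X_prime (i := Sum.inl ⟨(a, b), hab⟩)).not_isUnit hf).exists_eq_pow_mul_and_not_dvd
    obtain ⟨h, n, hh⟩ := exists_clear_denominators hr g
    have hqh : ∀ y ∈ Z, MvPolynomial.aeval y q * MvPolynomial.aeval y h = 0 := by
      intro y hy
      rw [← map_mul]
      refine hZY hy _ ?_
      rintro _ ⟨⟨l, w, hw, rfl⟩, hS, hCI⟩
      rw [gaussianCI_iff_uncorr hS hjK, symMatrix_param, ← haeval l w hw, hfg, map_mul, map_pow,
        MvPolynomial.aeval_X, Sum.elim_inl] at hCI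
      rw [map_mul]
      rcases mul_eq_zero.1 hCI with hl | hg0
      · refine mul_eq_zero_of_left (hq _ (mem_dagModel_iff.2 ⟨edgeMatrix G l, w, ?_, hw, rfl⟩)) _
        exact fun u v h => adj_deleteEdge_of_edgeMatrix_ne_zero hab (eq_zero_of_pow_eq_zero hl) h
      · rw [hh, hg0, mul_zero, mul_zero]
    rcases hZ.forall_zero_or hqh with hZq | hZh
    · exact hZq x hx
    -- If `h` vanishes on `Z`, it vanishes on the smaller model. The denominators are nonzero there,
    -- so `g` vanishes where `λ_ab = 0`.
    · refine absurd (X_inl_dvd hab fun l w hw hl => ?_) hg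
      have hmem : param G l w ∈ dagModel (deleteEdge G a b) := mem_dagModel_iff.2
        ⟨edgeMatrix G l, w, fun u v h => adj_deleteEdge_of_edgeMatrix_ne_zero hab hl h, hw, rfl⟩
      have h0 := hZh _ (hWZ (subset_zariskiClosure _ hmem))
      rw [hh] at h0
      refine (mul_eq_zero.1 h0).resolve_left (pow_ne_zero _ (Finset.prod_ne_zero_iff.2 ?_))
      exact fun v _ => (det_predMatrix_pos (dagModel_subset_posDefCone hr' hmem) v).ne'
  · rw [hclosure]
    exact dagModel_nonempty _
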